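/- **Conventions.** Ordinary Young diagrams are denoted $\sigma,\rho,\tau$, and shifted Young diagrams (that is, strict partitions $\lambda=(\lambda_1>\dots>\lambda_{\ell(\lambda)}>0)$, with row $i$ shifted $i-1$ steps to the right) are denoted $\mu,\lambda$. $|\cdot|$ is the number of boxes, $\ell(\lambda)$ is the number of nonempty rows, and $c(\square)=j-i$ is the content of the box in row $i$ and column $j$. Write $\sigma\nearrow\rho$ (respectively $\mu\Nearrow\lambda$) if the second diagram is obtained from the first by adding one box. Let $f_\rho$ (respectively $g_\lambda$) be the number of paths $\varnothing\nearrow\cdots\nearrow\rho$ (respectively $\varnothing\Nearrow\cdots\Nearrow\lambda$). The *doubling* $\mathcal D\lambda$ is the ordinary Young diagram with Frobenius coordinates $(\lambda_1,\dots,\lambda_\ell\mid\lambda_1-1,\dots,\lambda_\ell-1)$; the diagrams of the form $\mathcal D\lambda$ are called *$\mathcal D$-symmetric*. The up transition probabilities of the $z$-measures are, for $\sigma\nearrow\rho$ and $\square=\rho\setminus\sigma$, $$p^{\uparrow}_{z,z'}(\sigma,\rho)=\frac{(z+c(\square))(z'+c(\square))}{zz'+|\sigma|}\cdot\frac{f_\rho}{(|\sigma|+1)f_\sigma},$$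 and those of Borodin's measures on strict partitions are, for $\mu\Nearrow\lambda$ and $\square=\lambda\setminus\mu$, $$p^{\Uparrow}_{\alpha}(\mu,\lambda)=\frac{c(\square)(c(\square)+1)+\alpha}{2|\mu|+\alpha}\cdot\frac{g_\lambda}{(|\mu|+1)g_\mu}\,2^{\ell(\mu)-\ell(\lambda)+1};$$ both are $0$ for all other pairs of diagrams. Let $\mathbb M^\alpha_n$ be the distribution after $n$ steps of the growth process of shifted diagrams that starts from $\varnothing$ and has transition probabilities $p^\Uparrow_\alpha$, i.e. $\mathbb M^\alpha_0=\delta_\varnothing$ and $\mathbb M^\alpha_{n+1}(\lambda)=\sum_\mu\mathbb M^\alpha_n(\mu)\,p^\Uparrow_\alpha(\mu,\lambda)$. **Proposition.** Let $\alpha>0$, $\nu=\tfrac12\sqrt{1-4\alpha}$ (principal value), $z=\nu-\tfrac12$ and $z'=-\nu-\tfrac12$. 1. The parameters $z,z'$ are admissible for the $z$-measures: either $z'=\bar z$ and $z\in\mathbb C\setminus\mathbb Z$, or $z,z'$ are real and $m<z,z'<m+1$ for some $m\in\mathbb Z$. 2. Let $\mu\Nearrow\lambda$. Then $\ell(\lambda)\in\{\ell(\mu),\ell(\mu)+1\}$.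 If $\ell(\lambda)=\ell(\mu)$, there are exactly two ordinary diagrams $\rho^{(a)}\ne\rho^{(b)}$ with $\mathcal D\mu\nearrow\rho^{(a),(b)}\nearrow\mathcal D\lambda$, and $$p^\Uparrow_\alpha(\mu,\lambda)=p^\uparrow_{z,z'}(\mathcal D\mu,\rho^{(a)})+p^\uparrow_{z,z'}(\mathcal D\mu,\rho^{(b)}).$$ If $\ell(\lambda)=\ell(\mu)+1$, there is exactly one ordinary diagram $\rho$ with $\mathcal D\mu\nearrow\rho\nearrow\mathcal D\lambda$, and $$p^\Uparrow_\alpha(\mu,\lambda)=p^\uparrow_{z,z'}(\mathcal D\mu,\rho).$$ 3. Consequently, the growth process for $\mathbb M^\alpha_n$ is the forced $\mathcal D$-symmetrization of the growth process for the $z$-measures with parameters $z,z'$. Precisely: if $\mathcal D\mu\nearrow\rho$, there is exactly one $\mathcal D$-symmetric $\tau$ with $\rho\nearrow\tau$. Consider the growth of ordinary diagrams that starts from $\varnothing$ and has steps numbered $0,1,2,\dots$, where each even step adds a box according to $p^\uparrow_{z,z'}$ and each odd step adds the unique box that makes the diagram $\mathcal D$-symmetric again. Let $W_k$ be its distribution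 after $k$ steps, given by the corresponding recursion from $W_0=\delta_\varnothing$. Then, for every $n\ge0$, $W_{2n}(\mathcal D\lambda)=\mathbb M^\alpha_n(\lambda)$ for all shifted diagrams $\lambda$, and $W_{2n}$ vanishes outside $\{\mathcal D\lambda:|\lambda|=n\}$. -/

import Mathlib

/-- The content `j - i` of the box in row `i` and column `j`. Rows and columns are numbered
from `0`; this does not change contents. -/
def boxContent (c : ℕ × ℕ) : ℤ := (c.2 : ℤ) - (c.1 : ℤ)

/-- Paths `a → ⋯ → b` in the directed graph with edge relation `r`. -/
inductive UpPath {V : Type} (r : V → V → Prop) (a : V) : V → Type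
  | nil : UpPath r a a
  | snoc {b c : V} (p : UpPath r a b) (h : r b c) : UpPath r a c

/-! ### Ordinary Young diagrams -/

/-- `σ ↗ ρ`: the Young diagram `ρ` is obtained from `σ` by adding one box. -/
def YoungDiagram.Up (σ ρ : YoungDiagram) : Prop :=
  σ ≤ ρ ∧ ρ.card = σ.card + 1

/-- `f_ρ`: the number of paths in the Young graph from the empty diagram to `ρ`. -/
noncomputable def YoungDiagram.pathCount (ρ : YoungDiagram) : ℕ :=
  Nat.card (UpPath YoungDiagram.Up ⊥ ρ)

/-- The content of the box `ρ \ σ` (meaningful when `σ ↗ ρ`: then the sum has one term). -/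
def YoungDiagram.addedContent (σ ρ : YoungDiagram) : ℤ :=
  ∑ c ∈ ρ.cells \ σ.cells, boxContent c

open Classical in
/-- The up transition probabilities of the Plancherel measures on the Young graph. -/
noncomputable def YoungDiagram.plancherelUp (σ ρ : YoungDiagram) : ℝ :=
  if σ.Up ρ then (ρ.pathCount : ℝ) / (((σ.card : ℝ) + 1) * (σ.pathCount : ℝ)) else 0

/-- The up transition probabilities of the `z`-measures on the Young graph
(they vanish unless `σ ↗ ρ`, because `plancherelUp` does). -/
noncomputable def YoungDiagram.zUp (z z' : ℂ) (σ ρ : YoungDiagram) : ℂ :=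
  (z + (σ.addedContent ρ : ℂ)) * (z' + (σ.addedContent ρ : ℂ)) / (z * z' + (σ.card : ℂ))
    * (σ.plancherelUp ρ : ℂ)

/-- The admissible parameters of the `z`-measures: the principal and the complementary series. -/
def ZAdmissible (z z' : ℂ) : Prop :=
  (z' = (starRingEnd ℂ) z ∧ ∀ m : ℤ, z ≠ (m : ℂ)) ∨
  ∃ x x' : ℝ, z = (x : ℂ) ∧ z' = (x' : ℂ) ∧
    ∃ m : ℤ, (m : ℝ) < x ∧ x < m + 1 ∧ (m : ℝ) < x' ∧ x' < m + 1

/-! ### Shifted Young diagrams -/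

/-- A shifted Young diagram: a finite set of boxes `(i, j)` with `i ≤ j` which with each box
contains all boxes of `{(i, j) : i ≤ j}` weakly above and to the left of it.
The `i`-th row is `{(i, j) : i ≤ j < i + part i}`, where `part 0 > part 1 > ⋯` is the
corresponding strict partition (see `ShiftedDiagram.mem_iff` and
`ShiftedDiagram.part_succ_lt` below). -/
@[ext]
structure ShiftedDiagram where
  cells : Finset (ℕ × ℕ)
  le_of_mem : ∀ c ∈ cells, c.1 ≤ c.2
  closed : ∀ c ∈ cells, ∀ d : ℕ × ℕ, d.1 ≤ d.2 → d.1 ≤ c.1 → d.2 ≤ c.2 → d ∈ cells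

namespace ShiftedDiagram

/-- The empty shifted diagram. -/
def empty : ShiftedDiagram where
  cells := ∅
  le_of_mem := by simp
  closed := by simp

/-- `|lam|`: the number of boxes. -/
def card (lam : ShiftedDiagram) : ℕ := lam.cells.card

/-- The `i`-th part of the corresponding strict partition: the number of boxes in row `i`. -/
def part (lam : ShiftedDiagram) (i : ℕ) : ℕ := (lam.cells.filter fun c => c.1 = i).card

/-- `ℓ(lam)`: the number of nonempty rows. -/
def length (lam : ShiftedDiagram) : ℕ := (lam.cells.image Prod.fst).card

theorem mem_iff (lam : ShiftedDiagram) (i j : ℕ) :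
    (i, j) ∈ lam.cells ↔ i ≤ j ∧ j < i + lam.part i := by
  have key : ∀ j, (i, j) ∈ lam.cells → ∀ k, i ≤ k → k ≤ j → (i, k) ∈ lam.cells :=
    fun j hj k h1 h2 => lam.closed _ hj _ h1 le_rfl h2
  constructor
  · intro h
    have hij := lam.le_of_mem _ h
    refine ⟨hij, ?_⟩
    have hsub : (Finset.Icc i j).image (fun k => (i, k)) ⊆ lam.cells.filter fun c => c.1 = i := by
      intro c hc
      simp only [Finset.mem_image, Finset.mem_Icc] at hc
      obtain ⟨k, ⟨h1, h2⟩, rfl⟩ := hc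
      simp [key j h k h1 h2]
    have := Finset.card_le_card hsub
    rw [Finset.card_image_of_injective _ (fun a b hab => by simpa using hab), Nat.card_Icc] at this
    simp only at hij
    unfold part
    omega
  · rintro ⟨hij, hj⟩
    by_contra hn
    have hsub : (lam.cells.filter fun c => c.1 = i) ⊆ (Finset.Ico i j).image (fun k => (i, k)) := by
      rintro ⟨a, b⟩ hc
      simp only [Finset.mem_filter] at hc
      obtain ⟨hc, rfl⟩ := hc
      have hab := lam.le_of_mem _ hc
      simp only at hab
      have hb : b < j := by
        by_contra hb
        exact hn (key b hc j hij (not_lt.mp hb))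
      simp [hab, hb]
    have := Finset.card_le_card hsub
    rw [Finset.card_image_of_injective _ (fun a b hab => by simpa using hab), Nat.card_Ico] at this
    unfold part at hj
    omega

theorem part_succ_lt (lam : ShiftedDiagram) (i : ℕ) (h : lam.part (i + 1) ≠ 0) :
    lam.part (i + 1) < lam.part i := by
  have h1 : (i + 1, i + lam.part (i + 1)) ∈ lam.cells := by
    rw [mem_iff]; omega
  have h2 := lam.closed _ h1 (i, i + lam.part (i + 1)) (by simp) (by simp) le_rfl
  rw [mem_iff] at h2
  omega

theorem lt_length_iff (lam : ShiftedDiagram) (i : ℕ) :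
    i < lam.length ↔ 0 < lam.part i := by
  have hd : ∀ k, k ∈ lam.cells.image Prod.fst ↔ (k, k) ∈ lam.cells := by
    intro k
    simp only [Finset.mem_image]
    constructor
    · rintro ⟨c, hc, rfl⟩
      exact lam.closed c hc _ le_rfl le_rfl (lam.le_of_mem c hc)
    · intro h
      exact ⟨_, h, rfl⟩
  have hpos : (i, i) ∈ lam.cells ↔ 0 < lam.part i := by
    rw [mem_iff]; omega
  rw [← hpos]
  constructor
  · intro h
    by_contra hn
    have hsub : lam.cells.image Prod.fst ⊆ Finset.range i := by
      intro k hk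
      rw [hd] at hk
      rw [Finset.mem_range]
      by_contra hki
      exact hn (lam.closed _ hk (i, i) le_rfl (not_lt.mp hki) (not_lt.mp hki))
    have := Finset.card_le_card hsub
    rw [Finset.card_range] at this
    unfold length at h
    omega
  · intro h
    have hsub : Finset.range (i + 1) ⊆ lam.cells.image Prod.fst := by
      intro k hk
      rw [Finset.mem_range] at hk
      rw [hd]
      exact lam.closed _ h (k, k) le_rfl (by simp; omega) (by simp; omega)
    have := Finset.card_le_card hsub
    rw [Finset.card_range] at this
    unfold length
    omega

/-- `mu ⇗ lam`: the shifted diagram `lam` is obtained from `mu` by adding one box. -/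
def Up (mu lam : ShiftedDiagram) : Prop :=
  mu.cells ⊆ lam.cells ∧ lam.card = mu.card + 1

/-- `g_lam`: the number of paths in the Schur graph from the empty diagram to `lam`. -/
noncomputable def pathCount (lam : ShiftedDiagram) : ℕ :=
  Nat.card (UpPath Up empty lam)

/-- The content of the box `lam \ mu` (meaningful when `mu ⇗ lam`: then the sum has one term). -/
def addedContent (mu lam : ShiftedDiagram) : ℤ :=
  ∑ c ∈ lam.cells \ mu.cells, boxContent c

open Classical in
/-- The up transition probabilities of the Plancherel measures on the Schur graph. -/
noncomputable def plancherelUp (mu lam : ShiftedDiagram) : ℝ :=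
  if mu.Up lam then
    (lam.pathCount : ℝ) / (((mu.card : ℝ) + 1) * (mu.pathCount : ℝ))
      * (2 : ℝ) ^ ((mu.length : ℤ) - (lam.length : ℤ) + 1)
  else 0

/-- The up transition probabilities of Borodin's coherent system with parameter `α`
(they vanish unless `mu ⇗ lam`, because `plancherelUp` does). -/
noncomputable def alphaUp (α : ℝ) (mu lam : ShiftedDiagram) : ℝ :=
  ((mu.addedContent lam : ℝ) * ((mu.addedContent lam : ℝ) + 1) + α) / (2 * (mu.card : ℝ) + α)
    * mu.plancherelUp lam

open Classical in
/-- Borodin's measures on the levels of the Schur graph: the distribution, after `n` steps, of the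
random growth process that starts from the empty diagram and adds a box at each step with the up
transition probabilities `alphaUp α`. -/
noncomputable def alphaMeasure (α : ℝ) : ℕ → ShiftedDiagram → ℝ
  | 0, lam => if lam = empty then 1 else 0
  | n + 1, lam => ∑ᶠ mu : ShiftedDiagram, alphaMeasure α n mu * mu.alphaUp α lam

/-- The doubling `𝒟 lam`, with the `2 |lam|` boxes `(i, j + 1)` and `(j, i)` for `(i, j) ∈ lam`.
Its Frobenius coordinates are `(part 0, part 1, … | part 0 - 1, part 1 - 1, …)`,
see `doubling_frobenius`. -/
def doubling (lam : ShiftedDiagram) : YoungDiagram where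
  cells := lam.cells.image (fun c => (c.1, c.2 + 1)) ∪ lam.cells.image (fun c => (c.2, c.1))
  isLowerSet := by
    rintro ⟨a, b⟩ ⟨a', b'⟩ hle h
    obtain ⟨h1, h2⟩ := Prod.mk_le_mk.mp hle
    simp only [Finset.coe_union, Finset.coe_image, Set.mem_union, Set.mem_image,
      Finset.mem_coe, Prod.mk.injEq, Prod.exists] at h ⊢
    rcases lt_or_ge a' b' with hab | hab
    · left
      refine ⟨a', b' - 1, ?_, rfl, by omega⟩
      rcases h with ⟨i, j, hm, rfl, rfl⟩ | ⟨i, j, hm, rfl, rfl⟩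
      · exact lam.closed _ hm _ (by simp; omega) (by simp; omega) (by simp; omega)
      · have := lam.le_of_mem _ hm
        simp only at this
        exact lam.closed _ hm _ (by simp; omega) (by simp; omega) (by simp; omega)
    · right
      refine ⟨b', a', ?_, rfl, rfl⟩
      rcases h with ⟨i, j, hm, rfl, rfl⟩ | ⟨i, j, hm, rfl, rfl⟩
      · have := lam.le_of_mem _ hm
        simp only at this
        exact lam.closed _ hm _ (by simp; omega) (by simp; omega) (by simp; omega)
      · exact lam.closed _ hm _ (by simp; omega) (by simp; omega) (by simp; omega)

theorem mem_doubling (lam : ShiftedDiagram) (a b : ℕ) :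
    (a, b) ∈ lam.doubling ↔ (a < b ∧ (a, b - 1) ∈ lam.cells) ∨ (b ≤ a ∧ (b, a) ∈ lam.cells) := by
  rw [← YoungDiagram.mem_cells]
  simp only [doubling, Finset.mem_union, Finset.mem_image, Prod.mk.injEq, Prod.exists]
  constructor
  · rintro (⟨i, j, hm, rfl, rfl⟩ | ⟨i, j, hm, rfl, rfl⟩)
    · have := lam.le_of_mem _ hm
      simp only at this
      exact Or.inl ⟨by omega, by simpa using hm⟩
    · exact Or.inr ⟨lam.le_of_mem _ hm, hm⟩
  · rintro (⟨h, hm⟩ | ⟨h, hm⟩)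
    · exact Or.inl ⟨a, b - 1, hm, rfl, by omega⟩
    · exact Or.inr ⟨b, a, hm, rfl, rfl⟩

/-- The diagonal of `𝒟 lam` has `ℓ(lam)` boxes; its `i`-th box has arm length `part i` and leg
length `part i - 1`. -/
theorem doubling_frobenius (lam : ShiftedDiagram) (i : ℕ) :
    ((i, i) ∈ lam.doubling ↔ i < lam.length) ∧
    (i < lam.length → lam.doubling.rowLen i = (i + 1) + lam.part i ∧
      lam.doubling.colLen i = (i + 1) + (lam.part i - 1)) := by
  have hd : (i, i) ∈ lam.doubling ↔ i < lam.length := by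
    simp only [mem_doubling, lt_length_iff, mem_iff]
    omega
  refine ⟨hd, fun h => ?_⟩
  have hii := hd.mpr h
  have hp := (lt_length_iff lam i).mp h
  have hr := YoungDiagram.mem_iff_lt_rowLen.mp hii
  have hc := YoungDiagram.mem_iff_lt_colLen.mp hii
  constructor
  · refine le_antisymm ?_ ?_
    · by_contra hlt
      have h1 := YoungDiagram.mem_iff_lt_rowLen.mpr (not_le.mp hlt)
      rw [mem_doubling, mem_iff] at h1
      omega
    · by_contra hlt
      have h1 : (i, lam.doubling.rowLen i) ∈ lam.doubling := by
        rw [mem_doubling, mem_iff]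
        omega
      exact lt_irrefl _ (YoungDiagram.mem_iff_lt_rowLen.mp h1)
  · refine le_antisymm ?_ ?_
    · by_contra hlt
      have h1 := YoungDiagram.mem_iff_lt_colLen.mpr (not_le.mp hlt)
      rw [mem_doubling, mem_iff lam i] at h1
      omega
    · by_contra hlt
      have h1 : (lam.doubling.colLen i, i) ∈ lam.doubling := by
        rw [mem_doubling, mem_iff lam i]
        omega
      exact lt_irrefl _ (YoungDiagram.mem_iff_lt_colLen.mp h1)

end ShiftedDiagram

/-- A Young diagram is `𝒟`-symmetric if it is the doubling of a shifted diagram. -/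
def YoungDiagram.DSymmetric (τ : YoungDiagram) : Prop :=
  ∃ lam : ShiftedDiagram, lam.doubling = τ

/-! ### The parameters and the forced symmetrization -/

/-- `ν(α) = ½ √(1 - 4α)` (principal branch). -/
noncomputable def nuParam (α : ℝ) : ℂ := (1 / 2 : ℂ) * (1 - 4 * (α : ℂ)) ^ (1 / 2 : ℂ)

/-- `z(α) = ν(α) - ½`. -/
noncomputable def zParam (α : ℝ) : ℂ := nuParam α - 1 / 2

/-- `z'(α) = -ν(α) - ½`. -/
noncomputable def zParam' (α : ℝ) : ℂ := -nuParam α - 1 / 2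

open Classical in
/-- The transitions of the forced step: from `ρ` go to the `𝒟`-symmetric diagram that is obtained
from `ρ` by adding a box. -/
noncomputable def forcedStep (ρ τ : YoungDiagram) : ℂ :=
  if ρ.Up τ ∧ τ.DSymmetric then 1 else 0

open Classical in
/-- The distribution after `k` steps (numbered `0, 1, 2, …`) of the forced `𝒟`-symmetrization of the
growth process on the Young graph with up transition probabilities `zUp z z'`. The process starts
from the empty diagram; even steps use `zUp z z'`, odd steps are forced. -/
noncomputable def forcedGrowth (z z' : ℂ) : ℕ → YoungDiagram → ℂ
  | 0, ρ => if ρ = ⊥ then 1 else 0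
  | k + 1, ρ =>
    if Even k then ∑ᶠ σ : YoungDiagram, forcedGrowth z z' k σ * σ.zUp z z' ρ
    else ∑ᶠ σ : YoungDiagram, forcedGrowth z z' k σ * forcedStep σ ρ

/-!
Let `F(ρ) = f_ρ / |ρ|!`. Kerov's description of the cotransition probabilities by residues of a
rational function gives `F(σ) = F(ρ) w(σ, ρ)` for `σ ↗ ρ`, where `w(σ, ρ)` is an explicit product
over the contents of the boxes of `σ`: these weights agree along the two sides of a commuting
square, and by the residue theorem they sum to `|ρ|` over `σ`.

The contents of the boxes of `𝒟μ` are symmetric under `c ↦ 1 - c`. This relates the weights at the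
(one or two) diagrams between `𝒟μ` and `𝒟λ` to each other and gives
`2 ^ ℓ(λ) (∑ F(ρ)) ^ 2 = 4 * 2 ^ ℓ(μ) F(𝒟μ) F(𝒟λ)`, the sum running over these diagrams. Hence
the recursion for `F(𝒟λ)` says that the square root of `2 ^ ℓ(λ) F(𝒟λ)` satisfies the recursion for
`g_λ / |λ|!`, so the two are equal, and the Plancherel transition probability from `μ` to `λ` is the
sum of those from `𝒟μ` to `ρ` over the diagrams `ρ` between `𝒟μ` and `𝒟λ`.

Finally, if `c` is the content of the box of `λ` outside `μ`, then the box added to `𝒟μ` has content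
`d = c + 1` or `d = -c`, and `d (d - 1) = c (c + 1)`. Since `z + z' = -1` and `z z' = α`, this gives
`(z + d) (z' + d) = c (c + 1) + α` in both cases.
-/

/-! ### Sums of residues -/

section Residues

open Polynomial

theorem two_mul_esymm_two {R : Type*} [CommRing R] (s : Multiset R) :
    2 * s.esymm 2 = s.sum ^ 2 - (s.map (· ^ 2)).sum := by
  induction s using Multiset.induction_on with
  | empty => simp [Multiset.esymm, Multiset.powersetCard_zero_right]
  | cons a s ih =>
    have hcons : (a ::ₘ s).esymm 2 = s.esymm 2 + a * s.sum := by
      simpa [Multiset.esymm, Multiset.powersetCard_cons, Multiset.powersetCard_one] using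
        Multiset.sum_map_mul_left (s := s) (a := a) (f := id)
    rw [hcons, mul_add, ih, Multiset.sum_cons, Multiset.map_cons, Multiset.sum_cons]
    ring

theorem degree_prod_X_sub_C_sub_lt {R : Type*} [CommRing R] {s t : Multiset R} {n : ℕ}
    (hs : s.card = n + 1) (ht : t.card = n + 1) (hsum : s.sum = t.sum) :
    ((s.map fun x => X - C x).prod - (t.map fun x => X - C x).prod).degree < (n : WithBot ℕ) := by
  nontriviality R
  rw [degree_lt_iff_coeff_zero]
  intro k hk
  rw [coeff_sub, sub_eq_zero]
  have hdeg : ∀ u : Multiset R, u.card = n + 1 → n + 1 < k →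
      (u.map fun x => X - C x).prod.coeff k = 0 := fun u hu hk' =>
    coeff_eq_zero_of_natDegree_lt <| by
      rwa [natDegree_multiset_prod_X_sub_C_eq_card, hu]
  obtain rfl | rfl | hk' : k = n ∨ k = n + 1 ∨ n + 1 < k := by omega
  · rw [s.prod_X_sub_C_coeff (by omega), t.prod_X_sub_C_coeff (by omega), hs, ht,
      Nat.add_sub_cancel_left]
    simp [Multiset.esymm, Multiset.powersetCard_one, hsum]
  · rw [s.prod_X_sub_C_coeff hs.ge, t.prod_X_sub_C_coeff ht.ge, hs, ht]
    simp [Multiset.esymm]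
  · rw [hdeg s hs hk', hdeg t ht hk']

theorem coeff_prod_X_sub_C_sub {F : Type*} [Field F] [NeZero (2 : F)] {s t : Multiset F} {n : ℕ}
    (hs : s.card = n + 2) (ht : t.card = n + 2) (hsum : s.sum = t.sum) :
    ((s.map fun x => X - C x).prod - (t.map fun x => X - C x).prod).coeff n
      = ((t.map (· ^ 2)).sum - (s.map (· ^ 2)).sum) / 2 := by
  rw [coeff_sub, s.prod_X_sub_C_coeff (by omega), t.prod_X_sub_C_coeff (by omega), hs, ht,
    Nat.add_sub_cancel_left, eq_div_iff two_ne_zero]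
  linear_combination two_mul_esymm_two s - two_mul_esymm_two t + (s.sum + t.sum) * hsum

theorem sum_residues_eq {ι κ F : Type*} [Field F] [NeZero (2 : F)] [DecidableEq κ]
    {s : Finset ι} {t : Finset κ} {x : ι → F} {y : κ → F} (hy : Set.InjOn y t)
    (hcard : s.card = t.card + 1) (hsum : ∑ j ∈ s, x j = ∑ i ∈ t, y i) :
    ∑ i ∈ t, (∏ j ∈ s, (y i - x j)) / ∏ j ∈ t.erase i, (y i - y j)
      = (∑ i ∈ t, y i ^ 2 - ∑ j ∈ s, x j ^ 2) / 2 := by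
  rcases hm : t.card with - | m
  · obtain rfl := Finset.card_eq_zero.mp hm
    obtain ⟨a, rfl⟩ := Finset.card_eq_one.mp hcard
    simp_all
  -- Modulo the nodal polynomial of `t`, the nodal polynomial of `s` is the difference `P`; the sum
  -- is the coefficient of `X ^ m` in its Lagrange interpolant, that is, in `P` itself.
  set P := Lagrange.nodal s x - X * Lagrange.nodal t y with hP
  have hP' : P = ((s.val.map x).map fun c => X - C c).prod
      - ((0 ::ₘ t.val.map y).map fun c => X - C c).prod := by
    simp [P, Lagrange.nodal_eq]
  have hs : (s.val.map x).card = m + 2 := by simp [hcard, hm]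
  have ht : (0 ::ₘ t.val.map y).card = m + 2 := by simp [hm]
  have hst : (s.val.map x).sum = (0 ::ₘ t.val.map y).sum := by simpa using hsum
  have hdeg : P.degree < t.card := by
    rw [hP', hm]
    exact degree_prod_X_sub_C_sub_lt hs ht hst
  have heval : ∀ i ∈ t, P.eval (y i) = ∏ j ∈ s, (y i - x j) := fun i hi => by
    rw [hP, eval_sub, eval_mul, Lagrange.eval_nodal_at_node hi, mul_zero, sub_zero,
      Lagrange.eval_nodal]
  calc
    _ = P.coeff (t.card - 1) := by
      rw [Lagrange.coeff_eq_sum hy hdeg]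
      exact Finset.sum_congr rfl fun i hi => by rw [heval i hi]
    _ = _ := by
      rw [hm, Nat.add_sub_cancel, hP', coeff_prod_X_sub_C_sub hs ht hst]
      simp

end Residues

/-! ### Graded graphs -/

/-- The directed graph with edge relation `r` is graded by `rk`, with base vertex `a` on level `0`
and finitely many edges into each vertex. -/
structure IsGradedGraph {V : Type} (r : V → V → Prop) (a : V) (rk : V → ℕ) : Prop where
  rank_base : rk a = 0
  rank_succ : ∀ {c b}, r c b → rk b = rk c + 1
  finite_down : ∀ b, {c | r c b}.Finite

namespace UpPath

variable {V : Type} {r : V → V → Prop} {a b : V}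

/-- A path that ends outside its starting point is a path followed by an edge. -/
def equivOfNe (h : b ≠ a) : UpPath r a b ≃ Σ c : {c // r c b}, UpPath r a c where
  toFun p := match b, p, h with
    | _, .nil, h => absurd rfl h
    | _, .snoc p h', _ => ⟨⟨_, h'⟩, p⟩
  invFun x := .snoc x.2 x.1.2
  left_inv p := by
    cases p with
    | nil => exact absurd rfl h
    | snoc p h' => rfl
  right_inv x := rfl

theorem card_self (h : ∀ c, ¬ r c a) : Nat.card (UpPath r a a) = 1 := by
  have eq_nil : ∀ p : UpPath r a a, p = .nil
    | .nil => rfl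
    | .snoc _ h' => absurd h' (h _)
  exact Nat.card_eq_one_iff_unique.2 ⟨⟨fun p q => (eq_nil p).trans (eq_nil q).symm⟩, ⟨.nil⟩⟩

end UpPath

namespace IsGradedGraph

variable {V : Type} {r : V → V → Prop} {a b c : V} {rk : V → ℕ}

theorem not_rel_base (hG : IsGradedGraph r a rk) (c : V) : ¬ r c a := fun h => by
  simpa [hG.rank_base] using hG.rank_succ h

theorem finite_upPath (hG : IsGradedGraph r a rk) (b : V) : Finite (UpPath r a b) := by
  induction hn : rk b using Nat.strong_induction_on generalizing b with
  | _ n ih =>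
    rcases eq_or_ne b a with rfl | hb
    · exact Nat.finite_of_card_ne_zero (by simp [UpPath.card_self hG.not_rel_base])
    · have : Finite {c // r c b} := hG.finite_down b
      have : ∀ c : {c // r c b}, Finite (UpPath r a c) := fun c =>
        ih _ (by have := hG.rank_succ c.2; omega) _ rfl
      exact Finite.of_equiv _ (UpPath.equivOfNe hb).symm

/-- The starting points of the edges into a vertex. -/
noncomputable def down (hG : IsGradedGraph r a rk) (b : V) : Finset V := (hG.finite_down b).toFinset

/-- The number of paths from the base vertex to `b`, divided by `(rk b)!`. This normalization turns
the recursion for the number of paths into `density_rec`. -/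
noncomputable def density (_hG : IsGradedGraph r a rk) (b : V) : ℝ :=
  Nat.card (UpPath r a b) / (rk b).factorial

variable (hG : IsGradedGraph r a rk)

theorem mem_down : c ∈ hG.down b ↔ r c b := by
  simp [down]

theorem card_upPath_eq_sum (h : b ≠ a) :
    Nat.card (UpPath r a b) = ∑ c ∈ hG.down b, Nat.card (UpPath r a c) := by
  have : Fintype {c // r c b} := Fintype.ofFinset (hG.down b) fun _ => hG.mem_down
  have : ∀ c : {c // r c b}, Finite (UpPath r a c) := fun c => hG.finite_upPath c
  rw [Nat.card_congr (UpPath.equivOfNe h), Nat.card_sigma]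
  exact (Finset.sum_subtype _ (fun _ => hG.mem_down) fun c => Nat.card (UpPath r a c)).symm

theorem card_upPath_pos (hG : IsGradedGraph r a rk) (hdown : ∀ b ≠ a, ∃ c, r c b) (b : V) :
    0 < Nat.card (UpPath r a b) := by
  induction hn : rk b using Nat.strong_induction_on generalizing b with
  | _ n ih =>
    rcases eq_or_ne b a with rfl | hb
    · simp [UpPath.card_self hG.not_rel_base]
    · rw [hG.card_upPath_eq_sum hb]
      obtain ⟨c, hc⟩ := hdown b hb
      refine Finset.sum_pos (fun c hc => ih _ ?_ c rfl) ⟨c, hG.mem_down.2 hc⟩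
      have := hG.rank_succ (hG.mem_down.1 hc)
      omega

theorem card_upPath_div_eq (h : r c b) :
    (Nat.card (UpPath r a b) : ℝ) / ((rk c + 1) * Nat.card (UpPath r a c))
      = hG.density b / hG.density c := by
  rw [density, density, hG.rank_succ h, Nat.factorial_succ]
  push_cast
  field_simp

theorem density_base : hG.density a = 1 := by
  simp [density, UpPath.card_self hG.not_rel_base, hG.rank_base]

theorem density_pos (hdown : ∀ b ≠ a, ∃ c, r c b) (b : V) : 0 < hG.density b :=
  div_pos (mod_cast hG.card_upPath_pos hdown b) (mod_cast Nat.factorial_pos _)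

theorem density_rec (h : b ≠ a) : ∑ c ∈ hG.down b, hG.density c = rk b * hG.density b := by
  rcases (hG.down b).eq_empty_or_nonempty with hempty | ⟨c₀, hc₀⟩
  · simp [density, hG.card_upPath_eq_sum h, hempty]
  have hrk : rk b ≠ 0 := by simp [hG.rank_succ (hG.mem_down.1 hc₀)]
  have hc : ∀ c ∈ hG.down b, hG.density c = Nat.card (UpPath r a c) / (rk b - 1).factorial :=
    fun c hc => by rw [density, hG.rank_succ (hG.mem_down.1 hc), Nat.add_sub_cancel]
  rw [Finset.sum_congr rfl hc, ← Finset.sum_div, density, hG.card_upPath_eq_sum h,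
    ← Nat.mul_factorial_pred hrk]
  push_cast
  field_simp

theorem eq_density_of_rec {h : V → ℝ} (hbase : h a = 1)
    (hrec : ∀ b ≠ a, ∑ c ∈ hG.down b, h c = rk b * h b) (hrk : ∀ b ≠ a, rk b ≠ 0) (b : V) :
    h b = hG.density b := by
  induction hn : rk b using Nat.strong_induction_on generalizing b with
  | _ n ih =>
    rcases eq_or_ne b a with rfl | hb
    · rw [hbase, density_base]
    · have hrk : (rk b : ℝ) ≠ 0 := mod_cast hrk b hb
      apply mul_left_cancel₀ hrk
      rw [← hrec b hb, ← hG.density_rec hb]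
      refine Finset.sum_congr rfl fun c hc => ih _ ?_ c rfl
      have := hG.rank_succ (hG.mem_down.1 hc)
      omega

/-- Weights that agree along the two sides of commuting squares and whose sum into each vertex is
its rank give, divided by the rank, the cotransition probabilities. -/
theorem density_eq_mul {w : V → V → ℝ} (hw : ∀ {c b}, r c b → w c b ≠ 0)
    (hsum : ∀ b, ∑ c ∈ hG.down b, w c b = rk b)
    (hsquare : ∀ {b c c'}, r c b → r c' b → c ≠ c' →
      ∃ d, r d c ∧ r d c' ∧ w d c * w c b = w d c' * w c' b) (h : r c b) :
    hG.density c = hG.density b * w c b := by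
  induction hn : rk b using Nat.strong_induction_on generalizing b c with
  | _ n ih =>
    have hb : b ≠ a := by rintro rfl; exact hG.not_rel_base _ h
    have hrk : (rk b : ℝ) ≠ 0 := by simp [hG.rank_succ h, Nat.cast_add_one_ne_zero]
    have hprop : ∀ c' ∈ hG.down b, hG.density c' * w c b = hG.density c * w c' b := by
      intro c' hc'
      rw [mem_down] at hc'
      rcases eq_or_ne c c' with rfl | hne
      · rfl
      obtain ⟨d, hdc, hdc', hw'⟩ := hsquare h hc' hne
      have hlt : ∀ {x}, r x b → rk x < n := fun hx => by have := hG.rank_succ hx; omega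
      apply mul_left_cancel₀ (hw hdc)
      linear_combination hG.density c' * hw' - w c' b * ih _ (hlt hc') hdc' rfl
        + w c' b * ih _ (hlt h) hdc rfl
    apply mul_left_cancel₀ hrk
    calc rk b * hG.density c = ∑ c' ∈ hG.down b, hG.density c * w c' b := by
          rw [← Finset.mul_sum, hsum, mul_comm]
      _ = (∑ c' ∈ hG.down b, hG.density c') * w c b := by
          rw [Finset.sum_mul, Finset.sum_congr rfl hprop]
      _ = rk b * (hG.density b * w c b) := by rw [hG.density_rec hb, mul_assoc]

end IsGradedGraph

/-! ### The Young graph -/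

section Boxes

/-- The finite set `t` of boxes is obtained from `s` by adding the box `b`. -/
def AddsBox (b : ℕ × ℕ) (s t : Finset (ℕ × ℕ)) : Prop := b ∉ s ∧ insert b s = t

variable {b x : ℕ × ℕ} {s t : Finset (ℕ × ℕ)}

theorem exists_addsBox_iff : (∃ b, AddsBox b s t) ↔ s ⊆ t ∧ t.card = s.card + 1 := by
  rw [eq_comm, ← Finset.exists_eq_insert_iff]
  rfl

theorem addsBox_erase (hb : b ∈ t) : AddsBox b (t.erase b) t :=
  ⟨Finset.notMem_erase b t, Finset.insert_erase hb⟩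

theorem AddsBox.eq_erase (h : AddsBox b s t) : s = t.erase b := by
  rw [← h.2, Finset.erase_insert h.1]

theorem AddsBox.mem_iff (h : AddsBox b s t) : x ∈ t ↔ x = b ∨ x ∈ s := by
  rw [← h.2, Finset.mem_insert]

theorem AddsBox.inter {b' : ℕ × ℕ} {s' : Finset (ℕ × ℕ)} (h : AddsBox b s t)
    (h' : AddsBox b' s' t) (hne : b ≠ b') : AddsBox b' (s ∩ s') s := by
  have hb' : b' ∈ s := (h.mem_iff.1 (h'.mem_iff.2 (.inl rfl))).resolve_left hne.symm
  have hs : s ∩ s' = s.erase b' := by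
    ext x
    have := h.mem_iff (x := x)
    have := h'.mem_iff (x := x)
    simp only [Finset.mem_inter, Finset.mem_erase]
    grind [AddsBox]
  exact hs ▸ addsBox_erase hb'

theorem AddsBox.mem (h : AddsBox b s t) : b ∈ t := h.mem_iff.2 (.inl rfl)

theorem AddsBox.sum_sdiff {M : Type*} [AddCommMonoid M] (h : AddsBox b s t) (f : ℕ × ℕ → M) :
    ∑ x ∈ t \ s, f x = f b := by
  rw [← h.2, Finset.insert_sdiff_cancel h.1, Finset.sum_singleton]

theorem AddsBox.prod_eq {M : Type*} [CommMonoid M] (h : AddsBox b s t) (f : ℕ × ℕ → M) :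
    ∏ x ∈ t, f x = f b * ∏ x ∈ s, f x := by
  rw [← h.2, Finset.prod_insert h.1]

end Boxes

namespace YoungGraph

/-- The removable boxes of a diagram. -/
def corners (ρ : YoungDiagram) : Finset (ℕ × ℕ) :=
  ρ.cells.filter fun b => (b.1 + 1, b.2) ∉ ρ ∧ (b.1, b.2 + 1) ∉ ρ

/-- The boxes that can be added to a diagram. -/
def outerCorners (ρ : YoungDiagram) : Finset (ℕ × ℕ) :=
  (insert (0, 0) (ρ.cells.image fun b => (b.1 + 1, b.2)) ∪
    ρ.cells.image fun b => (b.1, b.2 + 1)).filter fun b =>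
      b ∉ ρ ∧ (b.1 = 0 ∨ (b.1 - 1, b.2) ∈ ρ) ∧ (b.2 = 0 ∨ (b.1, b.2 - 1) ∈ ρ)

/-- The diagram without the boxes weakly below and to the right of `b`. If `b` is a corner, this
removes just the box `b`. -/
def truncate (ρ : YoungDiagram) (b : ℕ × ℕ) : YoungDiagram where
  cells := ρ.cells.filter fun x => ¬ b ≤ x
  isLowerSet := fun x y hyx hx => by
    simp only [Finset.coe_filter, Set.mem_ofPred_eq] at hx ⊢
    exact ⟨ρ.isLowerSet hyx hx.1, fun h => hx.2 (h.trans hyx)⟩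

variable {ρ σ σ' : YoungDiagram} {b b' : ℕ × ℕ} {i j : ℕ}

theorem mem_corners :
    (i, j) ∈ corners ρ ↔ (i, j) ∈ ρ ∧ (i + 1, j) ∉ ρ ∧ (i, j + 1) ∉ ρ := by
  simp [corners]

theorem mem_outerCorners : (i, j) ∈ outerCorners ρ ↔
    (i, j) ∉ ρ ∧ (i = 0 ∨ (i - 1, j) ∈ ρ) ∧ (j = 0 ∨ (i, j - 1) ∈ ρ) := by
  simp only [outerCorners, Finset.mem_filter, and_iff_right_iff_imp, Finset.mem_union,
    Finset.mem_insert, Finset.mem_image, YoungDiagram.mem_cells, Prod.exists, Prod.mk.injEq]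
  grind

theorem mem_of_mem_corners (hb : b ∈ corners ρ) : b ∈ ρ.cells := Finset.mem_of_mem_filter b hb

theorem boxes_eq_corners (ρ : YoungDiagram) :
    (({(0, 0)} : Finset (ℕ × ℕ)).val + (ρ.cells.image fun b => (b.1 + 1, b.2)).val
      + (ρ.cells.image fun b => (b.1, b.2 + 1)).val)
      + ((corners ρ).image fun b => (b.1 + 1, b.2 + 1)).val
    = (outerCorners ρ).val + ρ.cells.val
      + (ρ.cells.image fun b => (b.1 + 1, b.2 + 1)).val := by
  ext ⟨i, j⟩
  have above : ∀ {i j}, (i + 1, j) ∈ ρ → (i, j) ∈ ρ := ρ.up_left_mem (Nat.le_succ _) le_rfl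
  have left : ∀ {i j}, (i, j + 1) ∈ ρ → (i, j) ∈ ρ := ρ.up_left_mem le_rfl (Nat.le_succ _)
  simp only [Multiset.count_add, Multiset.count_eq_of_nodup (Finset.nodup _), Finset.mem_val,
    mem_outerCorners, Finset.mem_image, YoungDiagram.mem_cells, Prod.exists, Prod.mk.injEq,
    Finset.mem_singleton]
  rcases i with - | i <;> rcases j with - | j <;> simp <;> grind [mem_corners]

@[to_additive]
theorem prod_boxes_eq_prod_corners {M : Type*} [CommMonoid M] (ρ : YoungDiagram) (φ : ℤ → M) :
    φ 0 * (∏ b ∈ ρ.cells, φ (boxContent b - 1)) * (∏ b ∈ ρ.cells, φ (boxContent b + 1))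
      * ∏ b ∈ corners ρ, φ (boxContent b)
    = (∏ b ∈ outerCorners ρ, φ (boxContent b)) * (∏ b ∈ ρ.cells, φ (boxContent b))
      * ∏ b ∈ ρ.cells, φ (boxContent b) := by
  have h := congrArg (fun s => (s.map fun b => φ (boxContent b)).prod) (boxes_eq_corners ρ)
  simp only [Multiset.map_add, Multiset.prod_add, Finset.prod_map_val, Finset.prod_singleton] at h
  have shift : ∀ (s : Finset (ℕ × ℕ)) (k l : ℕ), ∏ b ∈ s.image (fun b => (b.1 + k, b.2 + l)),
      φ (boxContent b) = ∏ b ∈ s, φ (boxContent b + (l - k)) := by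
    intro s k l
    rw [Finset.prod_image (by simp [Set.InjOn, Prod.ext_iff])]
    refine Finset.prod_congr rfl fun b _ => congrArg φ ?_
    simp only [boxContent]
    push_cast
    ring
  have shift_down := shift ρ.cells 1 0
  have shift_right := shift ρ.cells 0 1
  have shift_diag := shift ρ.cells 1 1
  have shift_corners := shift (corners ρ) 1 1
  simp only [add_zero, Nat.cast_one, Nat.cast_zero, zero_sub, sub_zero, sub_self]
    at shift_down shift_right shift_diag shift_corners
  rw [shift_down, shift_right, shift_diag, shift_corners] at h
  simpa [boxContent, sub_eq_add_neg] using h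

theorem two_le_abs_boxContent_sub (hb : b ∈ corners ρ) (hb' : b' ∈ corners ρ) (hne : b ≠ b') :
    2 ≤ |boxContent b - boxContent b'| := by
  obtain ⟨i, j⟩ := b
  obtain ⟨i', j'⟩ := b'
  rw [mem_corners] at hb hb'
  have h1 : ¬ (i + 1 ≤ i' ∧ j ≤ j') := fun h => hb.2.1 (ρ.up_left_mem h.1 h.2 hb'.1)
  have h2 : ¬ (i ≤ i' ∧ j + 1 ≤ j') := fun h => hb.2.2 (ρ.up_left_mem h.1 h.2 hb'.1)
  have h3 : ¬ (i' + 1 ≤ i ∧ j' ≤ j) := fun h => hb'.2.1 (ρ.up_left_mem h.1 h.2 hb.1)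
  have h4 : ¬ (i' ≤ i ∧ j' + 1 ≤ j) := fun h => hb'.2.2 (ρ.up_left_mem h.1 h.2 hb.1)
  have h5 : ¬ (i = i' ∧ j = j') := fun h => hne (Prod.ext h.1 h.2)
  simp only [boxContent]
  rw [le_abs]
  omega

theorem boxContent_injOn_corners (ρ : YoungDiagram) : Set.InjOn boxContent (corners ρ) := by
  intro b hb b' hb' h
  by_contra hne
  simpa [h] using two_le_abs_boxContent_sub hb hb' hne

theorem boxContent_ne_of_mem_outerCorners (hb : b ∈ corners ρ) (hb' : b' ∈ outerCorners ρ) :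
    boxContent b ≠ boxContent b' := by
  obtain ⟨i, j⟩ := b
  obtain ⟨i', j'⟩ := b'
  rw [mem_corners] at hb
  rw [mem_outerCorners] at hb'
  simp only [boxContent]
  intro h
  rcases le_or_gt i' i with hi | hi
  · exact hb'.1 (ρ.up_left_mem hi (by omega) hb.1)
  · exact hb.2.2 (ρ.up_left_mem (by omega) (by omega) (hb'.2.1.resolve_left (by omega)))

theorem up_iff_exists_addsBox : σ.Up ρ ↔ ∃ b, AddsBox b σ.cells ρ.cells :=
  exists_addsBox_iff.symm

theorem mem_corners_of_addsBox (h : AddsBox b σ.cells ρ.cells) : b ∈ corners ρ := by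
  obtain ⟨i, j⟩ := b
  have not_mem : ∀ x ∈ ρ, x ≠ (i, j) → (i, j) ≤ x → False := fun x hx hne hle =>
    h.1 (σ.isLowerSet hle ((h.mem_iff.1 hx).resolve_left hne))
  exact mem_corners.2 ⟨h.mem, fun hx => not_mem _ hx (by simp) (by simp),
    fun hx => not_mem _ hx (by simp) (by simp)⟩

theorem addsBox_truncate (hb : b ∈ corners ρ) : AddsBox b (truncate ρ b).cells ρ.cells := by
  have htrunc : (truncate ρ b).cells = ρ.cells.erase b := by
    obtain ⟨i, j⟩ := b
    rw [mem_corners] at hb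
    ext ⟨i', j'⟩
    have h1 : (i', j') ∈ ρ → ¬ (i + 1 ≤ i' ∧ j ≤ j') := fun hx h =>
      hb.2.1 (ρ.up_left_mem h.1 h.2 hx)
    have h2 : (i', j') ∈ ρ → ¬ (i ≤ i' ∧ j + 1 ≤ j') := fun hx h =>
      hb.2.2 (ρ.up_left_mem h.1 h.2 hx)
    simp only [truncate, Finset.mem_filter, Finset.mem_erase, YoungDiagram.mem_cells,
      Prod.mk_le_mk, ne_eq, Prod.mk.injEq]
    grind
  exact htrunc ▸ addsBox_erase (mem_of_mem_corners hb)

theorem up_truncate (hb : b ∈ corners ρ) : (truncate ρ b).Up ρ :=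
  up_iff_exists_addsBox.2 ⟨b, addsBox_truncate hb⟩

theorem eq_truncate_of_addsBox (h : AddsBox b σ.cells ρ.cells) : σ = truncate ρ b :=
  YoungDiagram.ext (h.eq_erase.trans (addsBox_truncate (mem_corners_of_addsBox h)).eq_erase.symm)

theorem addedContent_of_addsBox (h : AddsBox b σ.cells ρ.cells) :
    σ.addedContent ρ = boxContent b :=
  h.sum_sdiff boxContent

theorem finite_setOf_up (ρ : YoungDiagram) : {σ : YoungDiagram | σ.Up ρ}.Finite := by
  refine ((corners ρ).finite_toSet.image (truncate ρ)).subset fun σ hσ => ?_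
  obtain ⟨b, hb⟩ := up_iff_exists_addsBox.1 hσ
  exact ⟨b, mem_corners_of_addsBox hb, (eq_truncate_of_addsBox hb).symm⟩

end YoungGraph

theorem youngGraph : IsGradedGraph YoungDiagram.Up ⊥ YoungDiagram.card where
  rank_base := by simp [YoungDiagram.card]
  rank_succ h := h.2
  finite_down := YoungGraph.finite_setOf_up

namespace YoungGraph

variable {ρ σ σ' : YoungDiagram} {b b' : ℕ × ℕ} {i j : ℕ}

theorem truncate_injOn_corners (ρ : YoungDiagram) : Set.InjOn (truncate ρ) (corners ρ) := by
  intro b hb b' hb' h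
  by_contra hne
  have hmem : b ∈ (truncate ρ b').cells :=
    ((addsBox_truncate hb').mem_iff.1 (mem_of_mem_corners hb)).resolve_left hne
  exact (addsBox_truncate hb).1 (h ▸ hmem)

theorem sum_down {M : Type*} [AddCommMonoid M] (ρ : YoungDiagram) (F : YoungDiagram → M) :
    ∑ σ ∈ youngGraph.down ρ, F σ = ∑ b ∈ corners ρ, F (truncate ρ b) := by
  refine (Finset.sum_bij (fun b _ => truncate ρ b) ?_ ?_ ?_ fun _ _ => rfl).symm
  · exact fun b hb => youngGraph.mem_down.2 (up_truncate hb)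
  · exact fun b hb b' hb' h => truncate_injOn_corners ρ hb hb' h
  · intro σ hσ
    obtain ⟨b, hb⟩ := up_iff_exists_addsBox.1 (youngGraph.mem_down.1 hσ)
    exact ⟨b, mem_corners_of_addsBox hb, (eq_truncate_of_addsBox hb).symm⟩

/-- The trailing coefficient of the polynomial `X + d`: the number `d`, replaced by `1` if `d = 0`.
Products of these numbers record rational functions of `u` at a zero or a pole. -/
noncomputable def trailing (d : ℤ) : ℝ := if d = 0 then 1 else d

/-- The leading coefficient at `u = 0` of `((u + d)² - 1) / (u + d)²`. -/
noncomputable def contentFactor (d : ℤ) : ℝ :=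
  trailing (d - 1) * trailing (d + 1) / trailing d ^ 2

/-- The product of `trailing c` and of the factors `contentFactor (c - boxContent b)` of the boxes.
If a box of content `c` can be added to `σ`, then this is, up to sign, the reciprocal of the residue
at `c` of the Cauchy transform of Kerov's transition measure of `σ`. -/
noncomputable def weight (σ : YoungDiagram) (c : ℤ) : ℝ :=
  trailing c * ∏ b ∈ σ.cells, contentFactor (c - boxContent b)

theorem trailing_of_ne_zero {d : ℤ} (h : d ≠ 0) : trailing d = d := if_neg h

theorem trailing_zero : trailing 0 = 1 := if_pos rfl

theorem trailing_ne_zero (d : ℤ) : trailing d ≠ 0 := by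
  rcases eq_or_ne d 0 with rfl | h
  · simp [trailing_zero]
  · simpa [trailing_of_ne_zero h] using h

theorem abs_trailing_neg (d : ℤ) : |trailing (-d)| = |trailing d| := by
  simp only [trailing, neg_eq_zero]
  split_ifs <;> simp

theorem contentFactor_ne_zero (d : ℤ) : contentFactor d ≠ 0 :=
  div_ne_zero (mul_ne_zero (trailing_ne_zero _) (trailing_ne_zero _))
    (pow_ne_zero _ (trailing_ne_zero _))

theorem abs_contentFactor_neg (d : ℤ) : |contentFactor (-d)| = |contentFactor d| := by
  rw [contentFactor, contentFactor, abs_div, abs_div, abs_mul, abs_mul, abs_pow, abs_pow,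
    abs_trailing_neg, ← abs_trailing_neg (-d - 1), ← abs_trailing_neg (-d + 1)]
  ring_nf

theorem contentFactor_zero : contentFactor 0 = -1 := by
  simp [contentFactor, trailing]

theorem contentFactor_of_two_le_abs {d : ℤ} (h : 2 ≤ |d|) :
    contentFactor d = ((d : ℝ) ^ 2 - 1) / (d : ℝ) ^ 2 := by
  rw [le_abs] at h
  rw [contentFactor, trailing_of_ne_zero (by omega), trailing_of_ne_zero (by omega),
    trailing_of_ne_zero (by omega)]
  push_cast
  ring

theorem weight_ne_zero (σ : YoungDiagram) (c : ℤ) : weight σ c ≠ 0 :=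
  mul_ne_zero (trailing_ne_zero _) (Finset.prod_ne_zero_iff.2 fun _ _ => contentFactor_ne_zero _)

theorem weight_of_addsBox (h : AddsBox b σ.cells ρ.cells) (c : ℤ) :
    weight ρ c = contentFactor (c - boxContent b) * weight σ c := by
  rw [weight, h.prod_eq, weight]
  ring

theorem weight_mul_prod_corners (ρ : YoungDiagram) (c : ℤ) :
    weight ρ c * ∏ y ∈ corners ρ, trailing (c - boxContent y)
      = ∏ x ∈ outerCorners ρ, trailing (c - boxContent x) := by
  have hparts := prod_boxes_eq_prod_corners ρ fun k => trailing (c - k)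
  have hcells : ∏ x ∈ ρ.cells, trailing (c - boxContent x) ≠ 0 :=
    Finset.prod_ne_zero_iff.2 fun _ _ => trailing_ne_zero _
  have hfactor : ∏ x ∈ ρ.cells, contentFactor (c - boxContent x)
      = (∏ x ∈ ρ.cells, trailing (c - (boxContent x + 1)))
        * (∏ x ∈ ρ.cells, trailing (c - (boxContent x - 1)))
        / (∏ x ∈ ρ.cells, trailing (c - boxContent x)) ^ 2 := by
    rw [← Finset.prod_pow, ← Finset.prod_mul_distrib, ← Finset.prod_div_distrib]
    refine Finset.prod_congr rfl fun x _ => ?_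
    rw [contentFactor, sub_sub, sub_add]
  rw [weight, hfactor]
  rw [sub_zero] at hparts
  field_simp
  linear_combination hparts

theorem prod_trailing_outerCorners (hb : b ∈ corners ρ) :
    ∏ x ∈ outerCorners ρ, trailing (boxContent b - boxContent x)
      = ∏ x ∈ outerCorners ρ, ((boxContent b : ℝ) - boxContent x) := by
  refine Finset.prod_congr rfl fun x hx => ?_
  rw [trailing_of_ne_zero (sub_ne_zero.2 (boxContent_ne_of_mem_outerCorners hb hx)), Int.cast_sub]

theorem prod_trailing_corners (hb : b ∈ corners ρ) :
    ∏ y ∈ corners ρ, trailing (boxContent b - boxContent y)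
      = ∏ y ∈ (corners ρ).erase b, ((boxContent b : ℝ) - boxContent y) := by
  rw [← Finset.mul_prod_erase _ _ hb, sub_self, trailing_zero, one_mul]
  refine Finset.prod_congr rfl fun y hy => ?_
  obtain ⟨hne, hy⟩ := Finset.mem_erase.1 hy
  have : boxContent b ≠ boxContent y := fun h => hne (boxContent_injOn_corners ρ hy hb h.symm)
  rw [trailing_of_ne_zero (sub_ne_zero.2 this), Int.cast_sub]

theorem weight_truncate_eq_residue (hb : b ∈ corners ρ) :
    weight (truncate ρ b) (boxContent b)
      = -((∏ x ∈ outerCorners ρ, ((boxContent b : ℝ) - boxContent x))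
        / ∏ y ∈ (corners ρ).erase b, ((boxContent b : ℝ) - boxContent y)) := by
  have hne : ∏ y ∈ corners ρ, trailing (boxContent b - boxContent y) ≠ 0 :=
    Finset.prod_ne_zero_iff.2 fun _ _ => trailing_ne_zero _
  have hweight := weight_of_addsBox (addsBox_truncate hb) (boxContent b)
  rw [sub_self, contentFactor_zero, neg_one_mul] at hweight
  rw [← prod_trailing_outerCorners hb, ← prod_trailing_corners hb,
    ← weight_mul_prod_corners, mul_div_cancel_right₀ _ hne, hweight, neg_neg]

theorem sum_weight (ρ : YoungDiagram) :
    ∑ σ ∈ youngGraph.down ρ, weight σ (σ.addedContent ρ) = ρ.card := by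
  have hcard := sum_boxes_eq_sum_corners ρ fun _ => 1
  have hsum := sum_boxes_eq_sum_corners ρ fun k => (k : ℝ)
  have hsq := sum_boxes_eq_sum_corners ρ fun k => (k : ℝ) ^ 2
  simp only [Finset.sum_const, smul_eq_mul, mul_one] at hcard
  push_cast at hsum hsq
  simp only [Finset.sum_add_distrib, Finset.sum_sub_distrib, add_sq, sub_sq, Finset.sum_const,
    nsmul_eq_mul, mul_one, one_pow, ← Finset.mul_sum] at hsum hsq
  have hinj : Set.InjOn (fun b => (boxContent b : ℝ)) (corners ρ) := fun b hb b' hb' h =>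
    boxContent_injOn_corners ρ hb hb' (Int.cast_injective h)
  have hres := sum_residues_eq (s := outerCorners ρ) (x := fun b => (boxContent b : ℝ)) hinj
    (by omega) (by linarith)
  have hweight : ∀ b ∈ corners ρ, weight (truncate ρ b) ((truncate ρ b).addedContent ρ)
      = -((∏ x ∈ outerCorners ρ, ((boxContent b : ℝ) - boxContent x))
        / ∏ y ∈ (corners ρ).erase b, ((boxContent b : ℝ) - boxContent y)) := fun b hb => by
    rw [addedContent_of_addsBox (addsBox_truncate hb), weight_truncate_eq_residue hb]
  rw [sum_down, Finset.sum_congr rfl hweight, Finset.sum_neg_distrib, hres, YoungDiagram.card]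
  linarith

theorem exists_up_of_ne_bot (hρ : ρ ≠ ⊥) : ∃ σ : YoungDiagram, σ.Up ρ := by
  by_contra hn
  have hdown : youngGraph.down ρ = ∅ :=
    Finset.eq_empty_of_forall_notMem fun σ hσ => hn ⟨σ, youngGraph.mem_down.1 hσ⟩
  have hcard := sum_weight ρ
  rw [hdown, Finset.sum_empty] at hcard
  exact hρ (YoungDiagram.ext (Finset.card_eq_zero.1 (mod_cast hcard.symm)))

theorem density_pos (ρ : YoungDiagram) : 0 < youngGraph.density ρ :=
  youngGraph.density_pos (fun _ => exists_up_of_ne_bot) ρ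

theorem exists_weight_mul_eq (h : σ.Up ρ) (h' : σ'.Up ρ) (hne : σ ≠ σ') :
    ∃ τ : YoungDiagram, τ.Up σ ∧ τ.Up σ' ∧
      weight τ (τ.addedContent σ) * weight σ (σ.addedContent ρ)
        = weight τ (τ.addedContent σ') * weight σ' (σ'.addedContent ρ) := by
  obtain ⟨b, hb⟩ := up_iff_exists_addsBox.1 h
  obtain ⟨b', hb'⟩ := up_iff_exists_addsBox.1 h'
  have hbb' : b ≠ b' := by
    rintro rfl
    exact hne ((eq_truncate_of_addsBox hb).trans (eq_truncate_of_addsBox hb').symm)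
  have hτ : AddsBox b' (σ ⊓ σ').cells σ.cells := hb.inter hb' hbb'
  have hτ' : AddsBox b (σ ⊓ σ').cells σ'.cells := by
    rw [inf_comm]
    exact hb'.inter hb hbb'.symm
  have hd : 2 ≤ |boxContent b - boxContent b'| :=
    two_le_abs_boxContent_sub (mem_corners_of_addsBox hb) (mem_corners_of_addsBox hb') hbb'
  have hd' : 2 ≤ |boxContent b' - boxContent b| := by rwa [abs_sub_comm]
  refine ⟨σ ⊓ σ', up_iff_exists_addsBox.2 ⟨_, hτ⟩, up_iff_exists_addsBox.2 ⟨_, hτ'⟩, ?_⟩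
  rw [addedContent_of_addsBox hτ, addedContent_of_addsBox hτ', addedContent_of_addsBox hb,
    addedContent_of_addsBox hb', weight_of_addsBox hτ, weight_of_addsBox hτ',
    contentFactor_of_two_le_abs hd, contentFactor_of_two_le_abs hd']
  push_cast
  rw [← neg_sub (boxContent b : ℝ), neg_sq]
  ring

theorem density_eq_mul_weight (h : σ.Up ρ) :
    youngGraph.density σ = youngGraph.density ρ * weight σ (σ.addedContent ρ) :=
  youngGraph.density_eq_mul (w := fun σ ρ => weight σ (σ.addedContent ρ))
    (fun _ => weight_ne_zero _ _) sum_weight exists_weight_mul_eq h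

theorem density_eq_mul_abs_weight (h : AddsBox b σ.cells ρ.cells) :
    youngGraph.density σ = youngGraph.density ρ * |weight σ (boxContent b)| := by
  have hσ := density_eq_mul_weight (up_iff_exists_addsBox.2 ⟨b, h⟩)
  rw [addedContent_of_addsBox h] at hσ
  have hpos : 0 < weight σ (boxContent b) :=
    pos_of_mul_pos_right (hσ ▸ density_pos σ) (density_pos ρ).le
  rw [abs_of_pos hpos, hσ]

theorem plancherelUp_eq (h : σ.Up ρ) :
    σ.plancherelUp ρ = youngGraph.density ρ / youngGraph.density σ := by
  rw [YoungDiagram.plancherelUp, if_pos h]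
  exact youngGraph.card_upPath_div_eq h

end YoungGraph

/-! ### Shifted diagrams and their doublings -/

theorem schurGraph :
    IsGradedGraph ShiftedDiagram.Up ShiftedDiagram.empty ShiftedDiagram.card where
  rank_base := rfl
  rank_succ h := h.2
  finite_down lam := by
    refine Set.Finite.of_finite_image (f := ShiftedDiagram.cells)
      (lam.cells.powerset.finite_toSet.subset ?_) fun _ _ _ _ => ShiftedDiagram.ext
    rintro _ ⟨mu, hmu, rfl⟩
    exact Finset.mem_coe.2 (Finset.mem_powerset.2 hmu.1)

namespace ShiftedDiagram

open YoungGraph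

variable {mu lam : ShiftedDiagram} {ρ : YoungDiagram} {i j : ℕ}

theorem mem_doubling_right (hij : i ≤ j) : (i, j + 1) ∈ lam.doubling ↔ (i, j) ∈ lam.cells := by
  rw [mem_doubling, Nat.add_sub_cancel]
  exact ⟨fun h => h.elim And.right fun h => by omega, fun h => .inl ⟨by omega, h⟩⟩

theorem mem_doubling_left (hij : i ≤ j) : (j, i) ∈ lam.doubling ↔ (i, j) ∈ lam.cells := by
  rw [mem_doubling]
  exact ⟨fun h => h.elim (fun h => by omega) And.right, fun h => .inr ⟨hij, h⟩⟩

theorem forall_box_iff {P : ℕ × ℕ → Prop} :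
    (∀ x, P x) ↔ ∀ i j, i ≤ j → P (i, j + 1) ∧ P (j, i) := by
  refine ⟨fun h i j _ => ⟨h _, h _⟩, fun h ⟨a, b⟩ => ?_⟩
  rcases lt_or_ge a b with hab | hab
  · obtain ⟨j, rfl⟩ := Nat.exists_eq_add_of_lt hab
    exact (h a (a + j) (by omega)).1
  · exact (h b a hab).2

theorem disjoint_doubling_cells (lam : ShiftedDiagram) :
    Disjoint (lam.cells.image fun c => (c.1, c.2 + 1)) (lam.cells.image fun c => (c.2, c.1)) := by
  simp only [Finset.disjoint_left, Finset.mem_image, not_exists, not_and]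
  rintro _ ⟨c, hc, rfl⟩ d hd e
  have := lam.le_of_mem c hc
  have := lam.le_of_mem d hd
  grind

@[to_additive]
theorem prod_doubling {M : Type*} [CommMonoid M] (lam : ShiftedDiagram) (φ : ℕ × ℕ → M) :
    ∏ x ∈ lam.doubling.cells, φ x = ∏ b ∈ lam.cells, φ (b.1, b.2 + 1) * φ b.swap := by
  rw [doubling, Finset.prod_union lam.disjoint_doubling_cells, Finset.prod_image, Finset.prod_image,
    Finset.prod_mul_distrib]
  · rfl
  · exact Prod.swap_injective.injOn
  · exact fun a _ b _ h => by grind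

theorem card_doubling (lam : ShiftedDiagram) : lam.doubling.card = 2 * lam.card := by
  rw [YoungDiagram.card, Finset.card_eq_sum_ones, sum_doubling, Finset.sum_const, smul_eq_mul,
    mul_comm, card]

theorem doubling_empty : empty.doubling = ⊥ := by
  ext
  simp [doubling, empty]

/-- The boxes of `ρ` above the diagonal, moved one step to the left. -/
def aboveDiag (ρ : YoungDiagram) : Finset (ℕ × ℕ) :=
  (ρ.cells.filter fun b => b.1 < b.2).image fun b => (b.1, b.2 - 1)

/-- The boxes of `ρ` weakly below the diagonal, transposed. -/
def belowDiag (ρ : YoungDiagram) : Finset (ℕ × ℕ) :=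
  (ρ.cells.filter fun b => ¬ b.1 < b.2).image Prod.swap

theorem mem_aboveDiag : (i, j) ∈ aboveDiag ρ ↔ i ≤ j ∧ (i, j + 1) ∈ ρ := by
  simp only [aboveDiag, Finset.mem_image, Finset.mem_filter, YoungDiagram.mem_cells, Prod.exists,
    Prod.mk.injEq]
  constructor
  · rintro ⟨a, b, ⟨h, hab⟩, rfl, rfl⟩
    exact ⟨by omega, by rwa [Nat.sub_add_cancel (by omega)]⟩
  · rintro ⟨h, hm⟩
    exact ⟨i, j + 1, ⟨hm, by omega⟩, rfl, rfl⟩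

theorem mem_belowDiag : (i, j) ∈ belowDiag ρ ↔ i ≤ j ∧ (j, i) ∈ ρ := by
  simp only [belowDiag, Finset.mem_image, Finset.mem_filter, YoungDiagram.mem_cells, Prod.exists,
    Prod.swap_prod_mk, Prod.mk.injEq, not_lt]
  grind

theorem card_aboveDiag_add_card_belowDiag (ρ : YoungDiagram) :
    (aboveDiag ρ).card + (belowDiag ρ).card = ρ.card := by
  rw [aboveDiag, belowDiag, Finset.card_image_of_injOn,
    Finset.card_image_of_injective _ Prod.swap_injective,
    Finset.card_filter_add_card_filter_not, YoungDiagram.card]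
  rintro ⟨a, b⟩ h ⟨a', b'⟩ h' e
  simp only [Finset.coe_filter, Set.mem_ofPred_eq, Prod.mk.injEq] at h h' e ⊢
  omega

/-- The smallest shifted diagram whose doubling contains `ρ`. -/
def hull (ρ : YoungDiagram) : ShiftedDiagram where
  cells := aboveDiag ρ ∪ belowDiag ρ
  le_of_mem := by
    rintro ⟨i, j⟩ h
    rw [Finset.mem_union, mem_aboveDiag, mem_belowDiag] at h
    exact h.elim And.left And.left
  closed := by
    rintro ⟨i, j⟩ h ⟨i', j'⟩ hle hi hj
    simp only [Finset.mem_union, mem_aboveDiag, mem_belowDiag] at h hle hi hj ⊢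
    refine h.imp (fun h => ⟨hle, ?_⟩) fun h => ⟨hle, ?_⟩
    · exact ρ.up_left_mem hi (by omega) h.2
    · exact ρ.up_left_mem hj hi h.2

/-- The largest shifted diagram whose doubling is contained in `ρ`. -/
def core (ρ : YoungDiagram) : ShiftedDiagram where
  cells := aboveDiag ρ ∩ belowDiag ρ
  le_of_mem := by
    rintro ⟨i, j⟩ h
    rw [Finset.mem_inter, mem_aboveDiag] at h
    exact h.1.1
  closed := by
    rintro ⟨i, j⟩ h ⟨i', j'⟩ hle hi hj
    simp only [Finset.mem_inter, mem_aboveDiag, mem_belowDiag] at h hle hi hj ⊢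
    exact ⟨⟨hle, ρ.up_left_mem hi (by omega) h.1.2⟩, hle, ρ.up_left_mem hj hi h.2.2⟩

theorem card_hull_add_card_core (ρ : YoungDiagram) : (hull ρ).card + (core ρ).card = ρ.card :=
  (Finset.card_union_add_card_inter _ _).trans (card_aboveDiag_add_card_belowDiag ρ)

theorem core_subset_hull (ρ : YoungDiagram) : (core ρ).cells ⊆ (hull ρ).cells :=
  Finset.inter_subset_left.trans Finset.subset_union_left

theorem le_doubling_iff : ρ ≤ lam.doubling ↔ (hull ρ).cells ⊆ lam.cells := by
  rw [SetLike.le_def, forall_box_iff, Finset.subset_iff, Prod.forall]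
  refine forall₂_congr fun i j => ?_
  rw [hull, Finset.mem_union, mem_aboveDiag, mem_belowDiag, ← and_or_left, and_imp]
  refine forall_congr' fun hij => ?_
  rw [mem_doubling_right hij, mem_doubling_left hij, or_imp]

theorem doubling_le_iff : mu.doubling ≤ ρ ↔ mu.cells ⊆ (core ρ).cells := by
  rw [SetLike.le_def, forall_box_iff, Finset.subset_iff, Prod.forall]
  refine forall₂_congr fun i j => ?_
  rw [core, Finset.mem_inter, mem_aboveDiag, mem_belowDiag, ← and_and_left]
  constructor
  · intro h hm
    have hij : i ≤ j := mu.le_of_mem _ hm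
    exact ⟨hij, (h hij).1 ((mem_doubling_right hij).2 hm), (h hij).2 ((mem_doubling_left hij).2 hm)⟩
  · intro h hij
    rw [mem_doubling_right hij, mem_doubling_left hij]
    exact ⟨fun hm => (h hm).2.1, fun hm => (h hm).2.2⟩

theorem hull_doubling (lam : ShiftedDiagram) : hull lam.doubling = lam :=
  ShiftedDiagram.ext ((le_doubling_iff.1 le_rfl).antisymm
    ((doubling_le_iff.1 le_rfl).trans (core_subset_hull _)))

theorem doubling_injective : Function.Injective doubling :=
  Function.LeftInverse.injective hull_doubling

theorem core_eq_of_up (h : mu.doubling.Up ρ) : core ρ = mu := by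
  have hsub := doubling_le_iff.1 h.1
  have hle := Finset.card_le_card (core_subset_hull ρ)
  have hsum := card_hull_add_card_core ρ
  rw [h.2, card_doubling] at hsum
  unfold card at hsum
  exact ShiftedDiagram.ext (Finset.eq_of_subset_of_card_le hsub (by omega)).symm

theorem hull_eq_of_up (h : ρ.Up lam.doubling) : hull ρ = lam := by
  have hsub := le_doubling_iff.1 h.1
  have hle := Finset.card_le_card (core_subset_hull ρ)
  have hsum := card_hull_add_card_core ρ
  have hcard := h.2
  rw [card_doubling] at hcard
  unfold card at hsum hcard
  exact ShiftedDiagram.ext (Finset.eq_of_subset_of_card_le hsub (by omega))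

theorem up_doubling_hull (h : mu.doubling.Up ρ) : ρ.Up (hull ρ).doubling := by
  have hsum := card_hull_add_card_core ρ
  have hcard := h.2
  rw [core_eq_of_up h] at hsum
  rw [card_doubling] at hcard
  exact ⟨le_doubling_iff.2 subset_rfl, by rw [card_doubling]; omega⟩

theorem doubling_core_up (h : ρ.Up lam.doubling) : (core ρ).doubling.Up ρ := by
  have hsum := card_hull_add_card_core ρ
  have hcard := h.2
  rw [hull_eq_of_up h] at hsum
  rw [card_doubling] at hcard
  exact ⟨doubling_le_iff.2 subset_rfl, by rw [card_doubling]; omega⟩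

theorem up_of_doubling_up (h : mu.doubling.Up ρ) (h' : ρ.Up lam.doubling) : mu.Up lam := by
  have hsub := core_subset_hull ρ
  rw [core_eq_of_up h, hull_eq_of_up h'] at hsub
  have hcard := h.2
  have hcard' := h'.2
  rw [card_doubling] at hcard hcard'
  exact ⟨hsub, by omega⟩

theorem existsUnique_forced (h : mu.doubling.Up ρ) :
    ∃! τ : YoungDiagram, ρ.Up τ ∧ τ.DSymmetric := by
  refine ⟨(hull ρ).doubling, ⟨up_doubling_hull h, _, rfl⟩, ?_⟩
  rintro _ ⟨h', lam, rfl⟩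
  rw [hull_eq_of_up h']

open Classical in
/-- The ordinary diagrams between the doublings of `mu` and of `lam`. -/
noncomputable def between (mu lam : ShiftedDiagram) : Finset YoungDiagram :=
  (youngGraph.down lam.doubling).filter fun ρ => mu.doubling.Up ρ

theorem mem_between : ρ ∈ between mu lam ↔ mu.doubling.Up ρ ∧ ρ.Up lam.doubling := by
  classical
  rw [between, Finset.mem_filter, youngGraph.mem_down, and_comm]

theorem sum_down_doubling {M : Type*} [AddCommMonoid M] (lam : ShiftedDiagram)
    (F : YoungDiagram → M) :
    ∑ ρ ∈ youngGraph.down lam.doubling, F ρ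
      = ∑ mu ∈ schurGraph.down lam, ∑ ρ ∈ between mu lam, F ρ := by
  classical
  have hcore : ∀ ρ ∈ youngGraph.down lam.doubling, core ρ ∈ schurGraph.down lam := fun ρ hρ => by
    rw [youngGraph.mem_down] at hρ
    exact schurGraph.mem_down.2 (up_of_doubling_up (doubling_core_up hρ) hρ)
  rw [← Finset.sum_fiberwise_of_maps_to hcore]
  refine Finset.sum_congr rfl fun mu _ => Finset.sum_congr ?_ fun _ _ => rfl
  ext ρ
  rw [Finset.mem_filter, mem_between, youngGraph.mem_down, and_comm, and_congr_left_iff]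
  exact fun h => ⟨fun e => e ▸ doubling_core_up h, core_eq_of_up⟩

theorem exists_addsBox_of_up (h : mu.Up lam) :
    (∃ i j, i < j ∧ AddsBox (i, j) mu.cells lam.cells) ∨
      ∃ i, AddsBox (i, i) mu.cells lam.cells := by
  obtain ⟨⟨i, j⟩, hb⟩ := exists_addsBox_iff.2 h
  have hij : i ≤ j := lam.le_of_mem _ hb.mem
  rcases hij.lt_or_eq with hij | rfl
  · exact .inl ⟨i, j, hij, hb⟩
  · exact .inr ⟨i, hb⟩

theorem addedContent_of_addsBox {b : ℕ × ℕ} (h : AddsBox b mu.cells lam.cells) :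
    mu.addedContent lam = boxContent b :=
  h.sum_sdiff boxContent

theorem length_of_addsBox_of_lt (h : AddsBox (i, j) mu.cells lam.cells) (hij : i < j) :
    lam.length = mu.length := by
  have hdiag : (i, i) ∈ mu.cells :=
    (h.mem_iff.1 (lam.closed _ h.mem (i, i) le_rfl le_rfl hij.le)).resolve_left (by simp [hij.ne])
  have hrow : i ∈ mu.cells.image Prod.fst := Finset.mem_image_of_mem Prod.fst hdiag
  rw [length, ← h.2, Finset.image_insert, Finset.insert_eq_of_mem hrow, length]

theorem length_of_addsBox_diag (h : AddsBox (i, i) mu.cells lam.cells) :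
    lam.length = mu.length + 1 := by
  rw [length, ← h.2, Finset.image_insert, Finset.card_insert_of_notMem, length]
  intro hi
  obtain ⟨c, hc, rfl⟩ := Finset.mem_image.1 hi
  exact h.1 (mu.closed c hc _ le_rfl le_rfl (mu.le_of_mem c hc))

theorem length_of_up (h : mu.Up lam) : lam.length = mu.length ∨ lam.length = mu.length + 1 := by
  rcases exists_addsBox_of_up h with ⟨i, j, hij, h⟩ | ⟨i, h⟩
  · exact .inl (length_of_addsBox_of_lt h hij)
  · exact .inr (length_of_addsBox_diag h)

theorem doubling_cells_of_addsBox (h : AddsBox (i, j) mu.cells lam.cells) :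
    lam.doubling.cells = insert (i, j + 1) (insert (j, i) mu.doubling.cells) := by
  ext x
  simp only [doubling, ← h.2, Finset.image_insert, Finset.mem_union, Finset.mem_insert]
  tauto

theorem right_mem_corners (h : AddsBox (i, j) mu.cells lam.cells) :
    (i, j + 1) ∈ corners lam.doubling := by
  have hij : i ≤ j := lam.le_of_mem _ h.mem
  have hmax : ∀ x ∈ lam.cells, (i, j) ≤ x → x = (i, j) := fun x hx hle =>
    (h.mem_iff.1 hx).resolve_right fun hx => h.1 (mu.closed x hx _ hij hle.1 hle.2)
  rw [mem_corners, mem_doubling_right hij, mem_doubling_right (hij.trans j.le_succ)]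
  refine ⟨h.mem, fun hx => ?_, fun hx => by simpa using hmax _ hx (by simp)⟩
  rcases hij.lt_or_eq with hlt | rfl
  · exact absurd (hmax _ ((mem_doubling_right hlt).1 hx) (by simp)) (by simp)
  · exact absurd (hmax _ ((mem_doubling_left le_rfl).1 hx) (by simp)) (by simp)

theorem left_mem_corners (h : AddsBox (i, j) mu.cells lam.cells) (hij : i < j) :
    (j, i) ∈ corners lam.doubling := by
  have hmax : ∀ x ∈ lam.cells, (i, j) ≤ x → x = (i, j) := fun x hx hle =>
    (h.mem_iff.1 hx).resolve_right fun hx => h.1 (mu.closed x hx _ hij.le hle.1 hle.2)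
  rw [mem_corners, mem_doubling_left hij.le, mem_doubling_left (hij.le.trans j.le_succ),
    mem_doubling_left hij]
  exact ⟨h.mem, fun hx => absurd (hmax _ hx (by simp)) (by simp),
    fun hx => absurd (hmax _ hx (by simp)) (by simp)⟩

theorem addsBox_truncate_right (h : AddsBox (i, j) mu.cells lam.cells) :
    AddsBox (j, i) mu.doubling.cells (truncate lam.doubling (i, j + 1)).cells := by
  have hij : i ≤ j := lam.le_of_mem _ h.mem
  refine ⟨mt (mem_doubling_left hij).1 h.1, ?_⟩
  rw [(addsBox_truncate (right_mem_corners h)).eq_erase, doubling_cells_of_addsBox h,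
    Finset.erase_insert]
  rw [Finset.mem_insert, not_or]
  exact ⟨by simp only [Prod.mk.injEq]; omega, mt (mem_doubling_right hij).1 h.1⟩

theorem addsBox_truncate_left (h : AddsBox (i, j) mu.cells lam.cells) (hij : i < j) :
    AddsBox (i, j + 1) mu.doubling.cells (truncate lam.doubling (j, i)).cells := by
  refine ⟨mt (mem_doubling_right hij.le).1 h.1, ?_⟩
  rw [(addsBox_truncate (left_mem_corners h hij)).eq_erase, doubling_cells_of_addsBox h,
    Finset.insert_comm, Finset.erase_insert]
  rw [Finset.mem_insert, not_or]
  exact ⟨by simp only [Prod.mk.injEq]; omega, mt (mem_doubling_left hij.le).1 h.1⟩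

theorem exists_eq_truncate_of_mem_between (h : AddsBox (i, j) mu.cells lam.cells)
    (hρ : ρ ∈ between mu lam) :
    ρ = truncate lam.doubling (i, j + 1) ∨ i < j ∧ ρ = truncate lam.doubling (j, i) := by
  obtain ⟨hmu, hlam⟩ := mem_between.1 hρ
  obtain ⟨x, hx⟩ := up_iff_exists_addsBox.1 hlam
  have hmem := hx.mem
  rw [doubling_cells_of_addsBox h, Finset.mem_insert, Finset.mem_insert] at hmem
  rcases hmem with rfl | rfl | hmem
  · exact .inl (eq_truncate_of_addsBox hx)
  · have hij : i ≤ j := lam.le_of_mem _ h.mem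
    refine .inr ⟨hij.lt_of_ne ?_, eq_truncate_of_addsBox hx⟩
    rintro rfl
    exact (mem_corners.1 (mem_corners_of_addsBox hx)).2.2 ((mem_doubling_right le_rfl).2 h.mem)
  · exact absurd (hmu.1 hmem) hx.1

theorem truncate_right_mem_between (h : AddsBox (i, j) mu.cells lam.cells) :
    truncate lam.doubling (i, j + 1) ∈ between mu lam :=
  mem_between.2 ⟨up_iff_exists_addsBox.2 ⟨_, addsBox_truncate_right h⟩,
    up_truncate (right_mem_corners h)⟩

open Classical in
theorem between_eq_pair (h : AddsBox (i, j) mu.cells lam.cells) (hij : i < j) :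
    between mu lam = {truncate lam.doubling (j, i), truncate lam.doubling (i, j + 1)} := by
  ext ρ
  rw [Finset.mem_insert, Finset.mem_singleton]
  constructor
  · exact fun hρ => (exists_eq_truncate_of_mem_between h hρ).symm.imp_left And.right
  · rintro (rfl | rfl)
    · exact mem_between.2 ⟨up_iff_exists_addsBox.2 ⟨_, addsBox_truncate_left h hij⟩,
        up_truncate (left_mem_corners h hij)⟩
    · exact truncate_right_mem_between h

theorem truncate_left_ne_truncate_right (h : AddsBox (i, j) mu.cells lam.cells) (hij : i < j) :
    truncate lam.doubling (j, i) ≠ truncate lam.doubling (i, j + 1) :=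
  (truncate_injOn_corners _).ne (left_mem_corners h hij) (right_mem_corners h)
    (by simp only [ne_eq, Prod.mk.injEq]; omega)

theorem between_eq_singleton (h : AddsBox (i, i) mu.cells lam.cells) :
    between mu lam = {truncate lam.doubling (i, i + 1)} := by
  refine Finset.eq_singleton_iff_unique_mem.2 ⟨truncate_right_mem_between h, fun ρ hρ => ?_⟩
  exact (exists_eq_truncate_of_mem_between h hρ).resolve_right fun hlt => hlt.1.false

theorem card_between_of_length_eq (h : mu.Up lam) (hl : lam.length = mu.length) :
    (between mu lam).card = 2 := by
  classical
  rcases exists_addsBox_of_up h with ⟨i, j, hij, h⟩ | ⟨i, h⟩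
  · rw [between_eq_pair h hij, Finset.card_pair (truncate_left_ne_truncate_right h hij)]
  · have := length_of_addsBox_diag h
    omega

theorem card_between_of_length_eq_succ (h : mu.Up lam) (hl : lam.length = mu.length + 1) :
    (between mu lam).card = 1 := by
  rcases exists_addsBox_of_up h with ⟨i, j, hij, h⟩ | ⟨i, h⟩
  · have := length_of_addsBox_of_lt h hij
    omega
  · rw [between_eq_singleton h, Finset.card_singleton]

/-! ### The density of the Schur graph -/

theorem abs_weight_doubling_reflect (mu : ShiftedDiagram) (c : ℤ) :
    |trailing (1 - c)| * |weight mu.doubling c| = |trailing c| * |weight mu.doubling (1 - c)| := by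
  have hprod : ∏ x ∈ mu.doubling.cells, |contentFactor (c - boxContent x)|
      = ∏ x ∈ mu.doubling.cells, |contentFactor (1 - c - boxContent x)| := by
    -- The contents `d + 1` and `-d` of the two boxes coming from one box are exchanged by `1 - ·`.
    rw [prod_doubling, prod_doubling]
    refine Finset.prod_congr rfl fun b _ => ?_
    rw [mul_comm, ← abs_contentFactor_neg, ← abs_contentFactor_neg (c - _)]
    congr 3 <;> simp only [boxContent, Prod.fst_swap, Prod.snd_swap] <;> push_cast <;> ring
  rw [weight, weight, abs_mul, abs_mul, Finset.abs_prod, Finset.abs_prod, hprod]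
  ring

theorem mul_abs_weight_doubling (mu : ShiftedDiagram) {c : ℤ} (hc : 1 ≤ c) :
    c * |weight mu.doubling (c + 1)| = (c + 1) * |weight mu.doubling (-c)| := by
  have hcR : (1 : ℝ) ≤ c := mod_cast hc
  have hreflect := abs_weight_doubling_reflect mu (c + 1)
  rwa [show 1 - (c + 1) = -c by ring, abs_trailing_neg, trailing_of_ne_zero (by omega),
    trailing_of_ne_zero (by omega), Int.cast_add, Int.cast_one,
    abs_of_pos (by linarith : (0 : ℝ) < c), abs_of_pos (by linarith : (0 : ℝ) < c + 1)]
    at hreflect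

theorem abs_contentFactor_two_mul_add_one {c : ℤ} (hc : 1 ≤ c) :
    |contentFactor (2 * c + 1)| * (2 * c + 1) ^ 2 = 4 * c * (c + 1) := by
  have hcR : (1 : ℝ) ≤ c := mod_cast hc
  rw [contentFactor_of_two_le_abs (le_abs.2 (.inl (by omega)))]
  push_cast
  rw [abs_div, abs_of_nonneg (by nlinarith), abs_of_nonneg (by positivity),
    div_mul_cancel₀ _ (by positivity)]
  ring

theorem sq_sum_density_between_of_lt (h : AddsBox (i, j) mu.cells lam.cells) (hij : i < j) :
    (∑ ρ ∈ between mu lam, youngGraph.density ρ) ^ 2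
      = 4 * (youngGraph.density mu.doubling * youngGraph.density lam.doubling) := by
  classical
  obtain ⟨c, hc⟩ : ∃ c : ℤ, c = j - i := ⟨_, rfl⟩
  have hcpos : 1 ≤ c := by omega
  have hright : boxContent (i, j + 1) = c + 1 := by simp only [boxContent]; push_cast; omega
  have hleft : boxContent (j, i) = -c := by simp only [boxContent]; omega
  set F := youngGraph.density
  set A := F (truncate lam.doubling (j, i))
  set B := F (truncate lam.doubling (i, j + 1))
  have hmuA : F mu.doubling = A * |weight mu.doubling (c + 1)| :=
    hright ▸ density_eq_mul_abs_weight (addsBox_truncate_left h hij)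
  have hmuB : F mu.doubling = B * |weight mu.doubling (-c)| :=
    hleft ▸ density_eq_mul_abs_weight (addsBox_truncate_right h)
  have hlamB : B = F lam.doubling *
      (|contentFactor (2 * c + 1)| * |weight mu.doubling (c + 1)|) := by
    have hlam := density_eq_mul_abs_weight (addsBox_truncate (right_mem_corners h))
    rwa [hright, weight_of_addsBox (addsBox_truncate_right h), hleft, abs_mul,
      show c + 1 - -c = 2 * c + 1 by ring] at hlam
  have hreflect := mul_abs_weight_doubling mu hcpos
  have hfactor := abs_contentFactor_two_mul_add_one hcpos
  have hratio : (c + 1) * A = c * B := by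
    refine mul_right_cancel₀ (abs_ne_zero.2 (weight_ne_zero mu.doubling (-c))) ?_
    linear_combination c * hmuB - c * hmuA - A * hreflect
  rw [between_eq_pair h hij, Finset.sum_pair (truncate_left_ne_truncate_right h hij)]
  refine mul_left_cancel₀ (pow_ne_zero 2 (by positivity : (c : ℝ) + 1 ≠ 0)) ?_
  linear_combination ((c + 1) * (A + B) + (2 * c + 1) * B) * hratio
    + B * (2 * c + 1) ^ 2 * hlamB
    + B * F lam.doubling * |weight mu.doubling (c + 1)| * hfactor
    + 4 * (c + 1) * F lam.doubling * B * hreflect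
    - 4 * (c + 1) ^ 2 * F lam.doubling * hmuB

theorem sq_sum_density_between_of_diag (h : AddsBox (i, i) mu.cells lam.cells) :
    (∑ ρ ∈ between mu lam, youngGraph.density ρ) ^ 2
      = 2 * (youngGraph.density mu.doubling * youngGraph.density lam.doubling) := by
  have hzero : boxContent (i, i) = 0 := by simp [boxContent]
  have hone : boxContent (i, i + 1) = 1 := by simp [boxContent]
  have hmu := density_eq_mul_abs_weight (addsBox_truncate_right h)
  have hlam := density_eq_mul_abs_weight (addsBox_truncate (right_mem_corners h))
  have hreflect := abs_weight_doubling_reflect mu 1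
  have hfactor : |contentFactor 1| = 2 := by norm_num [contentFactor, trailing]
  rw [weight_of_addsBox (addsBox_truncate_right h), abs_mul, hzero, hone, sub_zero, hfactor] at hlam
  rw [hzero] at hmu
  rw [sub_self, trailing_zero, trailing_of_ne_zero one_ne_zero, Int.cast_one, abs_one, one_mul,
    one_mul] at hreflect
  rw [between_eq_singleton h, Finset.sum_singleton]
  linear_combination youngGraph.density (truncate lam.doubling (i, i + 1)) * hlam
    - 2 * youngGraph.density lam.doubling * hmu
    + 2 * youngGraph.density (truncate lam.doubling (i, i + 1)) * youngGraph.density lam.doubling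
      * hreflect

theorem two_pow_length_mul_sq_sum_density_between (h : mu.Up lam) :
    2 ^ lam.length * (∑ ρ ∈ between mu lam, youngGraph.density ρ) ^ 2
      = 4 * 2 ^ mu.length * (youngGraph.density mu.doubling * youngGraph.density lam.doubling) := by
  rcases exists_addsBox_of_up h with ⟨i, j, hij, h⟩ | ⟨i, h⟩
  · rw [sq_sum_density_between_of_lt h hij, length_of_addsBox_of_lt h hij]
    ring
  · rw [sq_sum_density_between_of_diag h, length_of_addsBox_diag h]
    ring

/-- The square root of `2 ^ ℓ(λ) F(𝒟λ)`, where `F` is the density of the Young graph. It turns out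
to be the density of the Schur graph, see `density_eq_rootDensity`. -/
noncomputable def rootDensity (lam : ShiftedDiagram) : ℝ :=
  √(2 ^ lam.length * youngGraph.density lam.doubling)

theorem rootDensity_pos (lam : ShiftedDiagram) : 0 < lam.rootDensity :=
  Real.sqrt_pos.2 (mul_pos (by positivity) (density_pos _))

theorem rootDensity_sq (lam : ShiftedDiagram) :
    lam.rootDensity ^ 2 = 2 ^ lam.length * youngGraph.density lam.doubling :=
  Real.sq_sqrt (mul_pos (by positivity) (density_pos _)).le

theorem two_mul_rootDensity_mul (h : mu.Up lam) :
    2 * (mu.rootDensity * lam.rootDensity)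
      = 2 ^ lam.length * ∑ ρ ∈ between mu lam, youngGraph.density ρ := by
  have hsum : 0 ≤ ∑ ρ ∈ between mu lam, youngGraph.density ρ :=
    Finset.sum_nonneg fun ρ _ => (density_pos ρ).le
  have hmu := mu.rootDensity_pos
  have hlam := lam.rootDensity_pos
  refine (sq_eq_sq₀ (by positivity) (by positivity)).1 ?_
  linear_combination 4 * lam.rootDensity ^ 2 * mu.rootDensity_sq
    + 4 * 2 ^ mu.length * youngGraph.density mu.doubling * lam.rootDensity_sq
    - 2 ^ lam.length * two_pow_length_mul_sq_sum_density_between h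

theorem sum_down_rootDensity (hne : lam ≠ empty) :
    ∑ mu ∈ schurGraph.down lam, mu.rootDensity = lam.card * lam.rootDensity := by
  have hbot : lam.doubling ≠ ⊥ := doubling_empty ▸ doubling_injective.ne hne
  have hrec := youngGraph.density_rec hbot
  rw [sum_down_doubling, card_doubling] at hrec
  refine mul_left_cancel₀ (mul_ne_zero two_ne_zero lam.rootDensity_pos.ne') ?_
  calc 2 * lam.rootDensity * ∑ mu ∈ schurGraph.down lam, mu.rootDensity
      = ∑ mu ∈ schurGraph.down lam, 2 * (mu.rootDensity * lam.rootDensity) := by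
        rw [Finset.mul_sum]
        exact Finset.sum_congr rfl fun _ _ => by ring
    _ = ∑ mu ∈ schurGraph.down lam,
          2 ^ lam.length * ∑ ρ ∈ between mu lam, youngGraph.density ρ :=
        Finset.sum_congr rfl fun mu hmu => two_mul_rootDensity_mul (schurGraph.mem_down.1 hmu)
    _ = 2 * lam.rootDensity * (lam.card * lam.rootDensity) := by
        rw [← Finset.mul_sum, hrec]
        push_cast
        linear_combination -2 * (lam.card : ℝ) * lam.rootDensity_sq

theorem rootDensity_empty : empty.rootDensity = 1 := by
  rw [rootDensity, doubling_empty, youngGraph.density_base]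
  simp [length, empty]

theorem card_ne_zero (hne : lam ≠ empty) : lam.card ≠ 0 := by
  rw [card, Finset.card_ne_zero, Finset.nonempty_iff_ne_empty]
  exact fun h => hne (ShiftedDiagram.ext h)

theorem density_eq_rootDensity (lam : ShiftedDiagram) :
    schurGraph.density lam = lam.rootDensity :=
  (schurGraph.eq_density_of_rec rootDensity_empty (fun _ => sum_down_rootDensity)
    (fun _ => card_ne_zero) lam).symm

theorem plancherelUp_eq (h : mu.Up lam) :
    mu.plancherelUp lam = ∑ ρ ∈ between mu lam, mu.doubling.plancherelUp ρ := by
  have hmu := mu.rootDensity_pos.ne'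
  have hD := (density_pos mu.doubling).ne'
  have hgraph : (lam.pathCount : ℝ) / ((mu.card + 1) * mu.pathCount)
      = lam.rootDensity / mu.rootDensity := by
    rw [← density_eq_rootDensity, ← density_eq_rootDensity]
    exact schurGraph.card_upPath_div_eq h
  have hsum : ∑ ρ ∈ between mu lam, mu.doubling.plancherelUp ρ
      = (∑ ρ ∈ between mu lam, youngGraph.density ρ) / youngGraph.density mu.doubling := by
    rw [Finset.sum_div]
    exact Finset.sum_congr rfl fun ρ hρ => YoungGraph.plancherelUp_eq (mem_between.1 hρ).1
  rw [plancherelUp, if_pos h, hgraph, hsum, zpow_add₀ two_ne_zero, zpow_sub₀ two_ne_zero,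
    zpow_natCast, zpow_natCast, zpow_one]
  field_simp
  linear_combination mu.rootDensity * two_mul_rootDensity_mul h
    - 2 * lam.rootDensity * mu.rootDensity_sq

theorem addedContent_mul_pred_of_mem_between (h : mu.Up lam) (hρ : ρ ∈ between mu lam) :
    mu.doubling.addedContent ρ * (mu.doubling.addedContent ρ - 1)
      = mu.addedContent lam * (mu.addedContent lam + 1) := by
  obtain ⟨⟨i, j⟩, hb⟩ := exists_addsBox_iff.2 h
  rw [addedContent_of_addsBox hb]
  rcases exists_eq_truncate_of_mem_between hb hρ with rfl | ⟨hij, rfl⟩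
  · rw [YoungGraph.addedContent_of_addsBox (addsBox_truncate_right hb)]
    simp only [boxContent]
    ring
  · rw [YoungGraph.addedContent_of_addsBox (addsBox_truncate_left hb hij)]
    simp only [boxContent]
    push_cast
    ring

variable {z z' : ℂ} {α : ℝ}

theorem alphaUp_eq_sum_zUp (hadd : z + z' = -1) (hmul : z * z' = α) (h : mu.Up lam) :
    (mu.alphaUp α lam : ℂ) = ∑ ρ ∈ between mu lam, mu.doubling.zUp z z' ρ := by
  rw [alphaUp, plancherelUp_eq h]
  push_cast
  rw [Finset.mul_sum]
  refine Finset.sum_congr rfl fun ρ hρ => ?_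
  have hcontent : (mu.doubling.addedContent ρ : ℂ) * (mu.doubling.addedContent ρ - 1)
      = mu.addedContent lam * (mu.addedContent lam + 1) :=
    mod_cast addedContent_mul_pred_of_mem_between h hρ
  have hnum : (z + mu.doubling.addedContent ρ) * (z' + mu.doubling.addedContent ρ)
      = mu.addedContent lam * (mu.addedContent lam + 1) + α := by
    linear_combination hmul + (mu.doubling.addedContent ρ : ℂ) * hadd + hcontent
  rw [YoungDiagram.zUp, hnum, hmul, card_doubling, Nat.cast_mul, Nat.cast_ofNat,
    add_comm (α : ℂ)]

theorem up_of_alphaUp_ne_zero (h : mu.alphaUp α lam ≠ 0) : mu.Up lam := by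
  by_contra hn
  exact h (by simp [alphaUp, plancherelUp, hn])

theorem alphaMeasure_succ (α : ℝ) (n : ℕ) (lam : ShiftedDiagram) :
    alphaMeasure α (n + 1) lam
      = ∑ mu ∈ schurGraph.down lam, alphaMeasure α n mu * mu.alphaUp α lam := by
  rw [alphaMeasure, finsum_eq_sum_of_support_subset]
  exact fun mu hmu => schurGraph.mem_down.2 (up_of_alphaUp_ne_zero (right_ne_zero_of_mul hmu))

end ShiftedDiagram

open ShiftedDiagram

/-! ### Forced symmetrization -/

section ForcedGrowth

variable {z z' : ℂ} {α : ℝ} {n : ℕ} {mu lam : ShiftedDiagram} {σ ρ τ : YoungDiagram}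

theorem zAdmissible_of_add_of_mul (hadd : z + z' = -1) (hmul : z * z' = α) (hα : 0 < α) :
    ZAdmissible z z' := by
  obtain rfl : z' = -1 - z := by linear_combination hadd
  have hre := congrArg Complex.re hmul
  have him := congrArg Complex.im hmul
  simp only [Complex.mul_re, Complex.mul_im, Complex.sub_re, Complex.sub_im, Complex.neg_re,
    Complex.neg_im, Complex.one_re, Complex.one_im, Complex.ofReal_re, Complex.ofReal_im]
    at hre him
  have hprod : z.im * (1 + 2 * z.re) = 0 := by linarith
  rcases mul_eq_zero.1 hprod with hzero | hhalf
  · have hreal : z = (z.re : ℂ) := Complex.ext rfl hzero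
    rw [hzero] at hre
    refine .inr ⟨z.re, -1 - z.re, hreal, by rw [hreal]; push_cast; simp, -1, ?_⟩
    push_cast
    refine ⟨?_, ?_, ?_, ?_⟩ <;> nlinarith
  · refine .inl ⟨Complex.ext ?_ ?_, fun m hm => ?_⟩
    · rw [Complex.conj_re, Complex.sub_re, Complex.neg_re, Complex.one_re]
      linarith
    · simp
    · have hint : 1 + 2 * m = 0 := by
        rw [hm, Complex.intCast_re] at hhalf
        exact_mod_cast hhalf
      omega

theorem nuParam_sq (α : ℝ) : nuParam α ^ 2 = (1 - 4 * (α : ℂ)) / 4 := by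
  have hsqrt : ((1 - 4 * (α : ℂ)) ^ (1 / 2 : ℂ)) ^ 2 = 1 - 4 * (α : ℂ) := by
    have := Complex.cpow_nat_inv_pow (1 - 4 * (α : ℂ)) two_ne_zero
    rwa [Nat.cast_ofNat, ← one_div] at this
  rw [nuParam, mul_pow, hsqrt]
  ring

theorem zParam_add_zParam' (α : ℝ) : zParam α + zParam' α = -1 := by
  rw [zParam, zParam']
  ring

theorem zParam_mul_zParam' (α : ℝ) : zParam α * zParam' α = α := by
  rw [zParam, zParam']
  linear_combination -nuParam_sq α

theorem up_of_zUp_ne_zero (h : σ.zUp z z' ρ ≠ 0) : σ.Up ρ := by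
  by_contra hn
  exact h (by simp [YoungDiagram.zUp, YoungDiagram.plancherelUp, hn])

theorem up_and_dSymmetric_of_forcedStep_ne_zero (h : forcedStep ρ τ ≠ 0) :
    ρ.Up τ ∧ τ.DSymmetric :=
  not_not.1 fun hn => h (if_neg hn)

theorem forcedGrowth_two_mul_add_one (z z' : ℂ) (n : ℕ) (ρ : YoungDiagram) :
    forcedGrowth z z' (2 * n + 1) ρ
      = ∑ᶠ σ : YoungDiagram, forcedGrowth z z' (2 * n) σ * σ.zUp z z' ρ := by
  rw [forcedGrowth, if_pos (even_two_mul n)]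

theorem forcedGrowth_two_mul_succ (z z' : ℂ) (n : ℕ) (τ : YoungDiagram) :
    forcedGrowth z z' (2 * (n + 1)) τ
      = ∑ᶠ ρ : YoungDiagram, forcedGrowth z z' (2 * n + 1) ρ * forcedStep ρ τ := by
  rw [mul_add_one, forcedGrowth, if_neg (by simp)]

theorem exists_doubling_eq_of_forcedGrowth_ne_zero (h : forcedGrowth z z' (2 * n) τ ≠ 0) :
    ∃ lam : ShiftedDiagram, lam.card = n ∧ lam.doubling = τ := by
  induction n generalizing τ with
  | zero =>
    exact ⟨empty, rfl, by simpa [forcedGrowth, doubling_empty, eq_comm] using h⟩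
  | succ n ih =>
    rw [forcedGrowth_two_mul_succ] at h
    obtain ⟨ρ, hρ⟩ := not_forall.1 (mt finsum_eq_zero_of_forall_eq_zero h)
    obtain ⟨hup', lam, rfl⟩ :=
      up_and_dSymmetric_of_forcedStep_ne_zero (right_ne_zero_of_mul hρ)
    have hodd := left_ne_zero_of_mul hρ
    rw [forcedGrowth_two_mul_add_one] at hodd
    obtain ⟨σ, hσ⟩ := not_forall.1 (mt finsum_eq_zero_of_forall_eq_zero hodd)
    obtain ⟨mu, hmu, rfl⟩ := ih (left_ne_zero_of_mul hσ)
    have hup := up_of_doubling_up (up_of_zUp_ne_zero (right_ne_zero_of_mul hσ)) hup'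
    exact ⟨lam, hmu ▸ hup.2, rfl⟩

theorem forcedGrowth_of_doubling_up (h : mu.doubling.Up ρ) :
    forcedGrowth z z' (2 * n + 1) ρ
      = forcedGrowth z z' (2 * n) mu.doubling * mu.doubling.zUp z z' ρ := by
  rw [forcedGrowth_two_mul_add_one]
  refine finsum_eq_single _ mu.doubling fun σ hσ => ?_
  by_contra hne
  obtain ⟨mu', -, rfl⟩ := exists_doubling_eq_of_forcedGrowth_ne_zero (left_ne_zero_of_mul hne)
  have h' := up_of_zUp_ne_zero (right_ne_zero_of_mul hne)
  exact hσ (by rw [← core_eq_of_up h', core_eq_of_up h])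

theorem forcedGrowth_succ_doubling (z z' : ℂ) (n : ℕ) (lam : ShiftedDiagram) :
    forcedGrowth z z' (2 * (n + 1)) lam.doubling
      = ∑ mu ∈ schurGraph.down lam, forcedGrowth z z' (2 * n) mu.doubling
        * ∑ ρ ∈ between mu lam, mu.doubling.zUp z z' ρ := by
  rw [forcedGrowth_two_mul_succ,
    finsum_eq_sum_of_support_subset (s := youngGraph.down lam.doubling) _ fun ρ hρ =>
      youngGraph.mem_down.2
        (up_and_dSymmetric_of_forcedStep_ne_zero (right_ne_zero_of_mul hρ)).1,
    sum_down_doubling]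
  refine Finset.sum_congr rfl fun mu _ => ?_
  rw [Finset.mul_sum]
  refine Finset.sum_congr rfl fun ρ hρ => ?_
  rw [mem_between] at hρ
  rw [forcedGrowth_of_doubling_up hρ.1, forcedStep, if_pos ⟨hρ.2, lam, rfl⟩, mul_one]

theorem forcedGrowth_doubling (hadd : z + z' = -1) (hmul : z * z' = α) (n : ℕ)
    (lam : ShiftedDiagram) :
    forcedGrowth z z' (2 * n) lam.doubling = (alphaMeasure α n lam : ℂ) := by
  classical
  induction n generalizing lam with
  | zero =>
    rw [mul_zero, forcedGrowth, alphaMeasure, ← doubling_empty, apply_ite Complex.ofReal,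
      Complex.ofReal_one, Complex.ofReal_zero]
    exact if_congr doubling_injective.eq_iff rfl rfl
  | succ n ih =>
    rw [forcedGrowth_succ_doubling, alphaMeasure_succ, Complex.ofReal_sum]
    refine Finset.sum_congr rfl fun mu hmu => ?_
    rw [ih, Complex.ofReal_mul, alphaUp_eq_sum_zUp hadd hmul (schurGraph.mem_down.1 hmu)]

end ForcedGrowth

theorem mainTheorem1 (α : ℝ) (hα : 0 < α) :
    -- the parameters are admissible for the z-measures
    ZAdmissible (zParam α) (zParam' α) ∧
    -- the identity between the up transition probabilities
    (∀ mu lam : ShiftedDiagram, mu.Up lam →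
      (lam.length = mu.length ∨ lam.length = mu.length + 1) ∧
      (lam.length = mu.length →
        ∃ ρa ρb : YoungDiagram, ρa ≠ ρb ∧
          (∀ ρ : YoungDiagram,
            (mu.doubling.Up ρ ∧ ρ.Up lam.doubling) ↔ (ρ = ρa ∨ ρ = ρb)) ∧
          (mu.alphaUp α lam : ℂ) =
            mu.doubling.zUp (zParam α) (zParam' α) ρa
              + mu.doubling.zUp (zParam α) (zParam' α) ρb) ∧
      (lam.length = mu.length + 1 →
        ∃ ρ₁ : YoungDiagram,
          (∀ ρ : YoungDiagram, (mu.doubling.Up ρ ∧ ρ.Up lam.doubling) ↔ ρ = ρ₁) ∧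
          (mu.alphaUp α lam : ℂ) = mu.doubling.zUp (zParam α) (zParam' α) ρ₁)) ∧
    -- the forced step of the growth process is well defined
    (∀ (mu : ShiftedDiagram) (ρ : YoungDiagram), mu.doubling.Up ρ →
      ∃! τ : YoungDiagram, ρ.Up τ ∧ τ.DSymmetric) ∧
    -- after 2n steps the forced growth process is at the doubling of a random shifted diagram
    -- with n boxes distributed according to Borodin's measure
    (∀ n : ℕ,
      (∀ lam : ShiftedDiagram,
        forcedGrowth (zParam α) (zParam' α) (2 * n) lam.doubling
          = (ShiftedDiagram.alphaMeasure α n lam : ℂ)) ∧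
      (∀ τ : YoungDiagram, forcedGrowth (zParam α) (zParam' α) (2 * n) τ ≠ 0 →
        ∃ lam : ShiftedDiagram, lam.card = n ∧ lam.doubling = τ)) := by
  classical
  have hadd := zParam_add_zParam' α
  have hmul := zParam_mul_zParam' α
  refine ⟨zAdmissible_of_add_of_mul hadd hmul hα,
    fun mu lam h => ⟨length_of_up h, fun hl => ?_, fun hl => ?_⟩,
    fun _ _ h => existsUnique_forced h,
    fun n => ⟨forcedGrowth_doubling hadd hmul n,
      fun _ => exists_doubling_eq_of_forcedGrowth_ne_zero⟩⟩
  · obtain ⟨ρa, ρb, hne, hpair⟩ := Finset.card_eq_two.1 (card_between_of_length_eq h hl)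
    refine ⟨ρa, ρb, hne, fun ρ => ?_, ?_⟩
    · rw [← mem_between, hpair, Finset.mem_insert, Finset.mem_singleton]
    · rw [alphaUp_eq_sum_zUp hadd hmul h, hpair, Finset.sum_pair hne]
  · obtain ⟨ρ₁, hsingle⟩ := Finset.card_eq_one.1 (card_between_of_length_eq_succ h hl)
    refine ⟨ρ₁, fun ρ => ?_, ?_⟩
    · rw [← mem_between, hsingle, Finset.mem_singleton]
    · rw [alphaUp_eq_sum_zUp hadd hmul h, hsingle, Finset.sum_singleton]
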